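/- **Setting.** All spaces are finite-dimensional, registers are finite, and $\|M\|=\operatorname{tr}\sqrt{M^\dagger M}$ is the trace norm (no factor $1/2$). For a density operator $\rho_{AE}$, $H_\infty(A|E)_\rho$ is the supremum of all $h\in\mathbb R$ such that $\rho_{AE}\le 2^{-h}\, I_A\otimes\sigma_E$ for some density operator $\sigma_E$. $U_\ell=I/2^\ell$ is the maximally mixed state of $\ell$ bits. *Sampling strategy.* Let $\Psi$ be a sampling strategy for words $q\in\mathcal A^N$ over a finite alphabet: a random choice $t$ (a subset of the $N$ positions, possibly together with further seed randomness) is drawn with distribution $P_T$; the strategy looks at the substring $q_t$ and outputs an outcome $s$ in a finite set $\bar{\mathcal S}$, which together with $t$ determines the guess $g(q_t)\in\mathbb R^k$; the target is $r(q_{-t})\in\mathbb R^k$ ($g$ and $r$ may depend on $t$). For $\delta>0$ put $\mathcal G^t_\delta=\{q:\max_j|g_j(q_t)-r_j(q_{-t})|\le\delta\}$ and $\epsilon^{cl}_\delta=\max_{q}\Pr_t(q\notin\mathcal G^t_\delta)$. Let $A=A_1\cdots A_N$, $B=B_1\cdots B_N$, where all the spaces $A_iB_i$ are copies of one bipartite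 space, and let $\{|a\rangle\}_{a\in\mathcal A}$ be an orthonormal basis of that space; $|q\rangle=|q_1\rangle\cdots|q_N\rangle$. *Ideal states.* Let $\rho_{ABE}$ be a density operator and $\rho^{(0)}_{TABE}=\sum_tP_T(t)|t\rangle\langle t|\otimes\rho_{ABE}$. An ideal state for it is an operator $\sigma^{(0)}_{TABE}=\sum_tP_T(t)|t\rangle\langle t|\otimes\sigma^t_{ABE}$ such that, for every $t$ with $P_T(t)>0$, $\sigma^t$ is a density operator whose range lies in $\operatorname{span}\{|q\rangle:q\in\mathcal G^t_\delta\}\otimes\mathcal H_E$, and $\tfrac12\|\rho^{(0)}-\sigma^{(0)}\|\le\sqrt{\epsilon^{cl}_\delta}$. *Protocol.* A generic sampling-based QKD protocol acts on a state of $TABE$ as follows. (1) Given $T=t$, the systems $A_iB_i$ at the positions in $t$ are measured in the given basis and discarded, and the outcome $s$ of $\Psi$ is stored in $S$. (2) A flag $R$ is set to $0$ if $s\in\mathcal S$ and to $1$ otherwise, where $\mathcal S\subset\bar{\mathcal S}$ is a fixed set of accepted outcomes. (3) If $R=1$ the protocol aborts, which is modelled by the zero operator. If $R=0$, a quantum instrument,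 which may depend on $t,s$, acts on the remaining systems and yields classical (error-corrected) raw keys $A,B$ with values in a finite set $X$, and Eve's system $E$, including all leaked information; the instrument is completely positive and trace non-increasing, the missing trace being the probability of aborting at this stage. The resulting operator is written $p_{ok}(\rho)\,\rho^*_{TSABE,R=0}$ with $\rho^*$ normalized, $p_{ok}(\rho)$ being the probability of not aborting on input $\rho^{(0)}$. (4) A function $f:X\to\{0,1\}^\ell$ is drawn from a two-universal family (with its distribution), stored in the register $F$, and applied to both raw keys. This gives $p_{ok}(\rho)\,\rho_{TSK_AK_BEF,R=0}$. **Lemma.** Let $\delta>0$, and let $\Psi$, the basis and $\rho_{ABE}$ be as above. (i) If $\mathcal G^t_\delta\neq\emptyset$ for every $t$ with $P_T(t)>0$, then there is an ideal state $\sigma^{(0)}$ for $\rho^{(0)}$; if $\rho_{ABE}$ is pure, it can be chosen with every $\sigma^t$, $P_T(t)>0$, pure. (ii) Let $\sigma^{(0)}$ be any ideal state for $\rho^{(0)}$, consider any protocol as above, and let $\gamma\in\mathbb R$ be such that $$H_\infty(A|E,T=t,S=s,R=0)_{\sigma^*}\ge\gamma$$ for all $t$ and all $s\in\mathcal S$ such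 that $T=t$, $S=s$, $R=0$ occurs with positive probability when the protocol is run on $\sigma^{(0)}$ (here $R=0$ denotes that the protocol has not aborted). Then, for every integer $\ell\ge0$ and every two-universal family, $$p_{ok}(\rho)\,\bigl\|\rho_{K_AQ}-U_\ell\otimes\rho_Q\bigr\|\le2^{-\frac12(\gamma-\ell)}+4\sqrt{\epsilon^{cl}_\delta},\qquad Q=(TSEF,R=0),$$ where the left-hand side is read as $0$ if $p_{ok}(\rho)=0$. -/

import Mathlib

open scoped Matrix Kronecker ComplexOrder

namespace QKD

/-! ### Finite-dimensional quantum states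

Operators on the Hilbert space with orthonormal basis indexed by a finite type `n` are matrices in
`Matrix n n ℂ`; the tensor product of two spaces is indexed by the product type. -/

section States

/-- Density operators. -/
def IsDensity {n : Type*} [Fintype n] (ρ : Matrix n n ℂ) : Prop :=
  ρ.PosSemidef ∧ ρ.trace = 1

/-- `ρ = |v⟩⟨v|` for some vector `v`. -/
def IsPure {n : Type*} (ρ : Matrix n n ℂ) : Prop :=
  ∃ v : n → ℂ, ρ = Matrix.vecMulVec v (star v)

/-- The trace norm `‖M‖ = tr √(M† M)`, i.e. the sum of the singular values of `M`
(without a factor `1/2`). -/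
noncomputable def traceNorm {n : Type*} [Fintype n] [DecidableEq n] (M : Matrix n n ℂ) : ℝ :=
  ∑ i, Real.sqrt ((Matrix.isHermitian_conjTranspose_mul_self M).eigenvalues i)

/-- The operator `∑ c, |c⟩⟨c| ⊗ B c`, with a classical register `C`. -/
def classicalQuantum {C n : Type*} [Fintype C] [DecidableEq C]
    (B : C → Matrix n n ℂ) : Matrix (C × n) (C × n) ℂ :=
  ∑ c, Matrix.single c c (1 : ℂ) ⊗ₖ B c

/-- `V ρ V†`. -/
def sandwich {m n : Type*} [Fintype n] (V : Matrix m n ℂ) (ρ : Matrix n n ℂ) : Matrix m m ℂ :=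
  V * ρ * V.conjTranspose

/-- Partial trace over the first tensor factor. -/
def traceLeft {m n : Type*} [Fintype m] (M : Matrix (m × n) (m × n) ℂ) : Matrix n n ℂ :=
  Matrix.of fun i j => ∑ k, M (k, i) (k, j)

/-- The maximally mixed state `U_ℓ = I / 2^ℓ` on `ℓ` bits. -/
noncomputable def uniformBits (ℓ : ℕ) : Matrix (Fin ℓ → Bool) (Fin ℓ → Bool) ℂ :=
  ((2 : ℂ) ^ ℓ)⁻¹ • 1

/-- The quantum conditional min-entropy (in bits) of a density operator `ρ` on `A ⊗ E`:
`H_∞(A|E)_ρ` is the supremum of all `h` such that `ρ ≤ 2^{-h} (I_A ⊗ σ)` for some density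
operator `σ` on `E`. -/
noncomputable def condMinEntropy {A E : Type*} [Fintype A] [DecidableEq A] [Fintype E]
    (ρ : Matrix (A × E) (A × E) ℂ) : ℝ :=
  sSup {h : ℝ | ∃ σ : Matrix E E ℂ, IsDensity σ ∧
    ((((2 : ℝ) ^ (-h) : ℝ) : ℂ) • ((1 : Matrix A A ℂ) ⊗ₖ σ) - ρ).PosSemidef}

/-- The map `Φ ⊗ id` on operators on `n ⊗ κ`. -/
def ampliation {n m : Type*} (Φ : Matrix n n ℂ →ₗ[ℂ] Matrix m m ℂ) {κ : Type*}
    (M : Matrix (n × κ) (n × κ) ℂ) : Matrix (m × κ) (m × κ) ℂ :=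
  Matrix.of fun x y => Φ (Matrix.of fun i j => M (i, x.2) (j, y.2)) x.1 y.1

/-- Complete positivity: `Φ ⊗ id_k` preserves positive semidefiniteness for every `k`. -/
def IsCompletelyPositive {n m : Type*} (Φ : Matrix n n ℂ →ₗ[ℂ] Matrix m m ℂ) : Prop :=
  ∀ (k : ℕ) (M : Matrix (n × Fin k) (n × Fin k) ℂ), M.PosSemidef → (ampliation Φ M).PosSemidef

end States

/-! ### Sampling strategies -/

/-- A classical sampling strategy for words of length `N` over the alphabet `𝒜`.

`τ` is the (finite) range of the random choice `T` made according to `P_T = prob`.  A choice `t`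
determines the subset `sub t` of tested positions (and may contain further seed randomness; the
basic case is `τ = Finset (Fin N)`, `sub t = t`).  Looking at the substring `q_t`, the strategy
outputs `outcome t q_t` in a finite set `Ω`, which determines the value of the guess function
`g(q_t) = guess t (outcome t q_t)` in `ℝ^k` (the basic case: `Ω` is the range of `g`).
The target function `r` is evaluated on the rest `q_{-t}`. -/
structure SamplingStrategy (𝒜 : Type*) (N k : ℕ) (τ Ω : Type*) [Fintype τ] where
  prob : τ → ℝ
  prob_nonneg : ∀ t, 0 ≤ prob t
  prob_sum : ∑ t, prob t = 1
  sub : τ → Finset (Fin N)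
  outcome : (t : τ) → ({i // i ∈ sub t} → 𝒜) → Ω
  guess : τ → Ω → Fin k → ℝ
  target : (t : τ) → ({i // i ∉ sub t} → 𝒜) → Fin k → ℝ

namespace SamplingStrategy

variable {𝒜 : Type*} {N k : ℕ} {τ Ω : Type*} [Fintype τ]

/-- The good words for `t`: `max_j |g_j(q_t) - r_j(q_{-t})| ≤ δ`. -/
def goodWords (Ψ : SamplingStrategy 𝒜 N k τ Ω) (δ : ℝ) (t : τ) : Set (Fin N → 𝒜) :=
  {q | ∀ j : Fin k,
    |Ψ.guess t (Ψ.outcome t fun i => q i) j - Ψ.target t (fun i => q i) j| ≤ δ}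

open Classical in
/-- The error probability `ε^cl_δ = max_q Pr_t (q ∉ 𝒢^t_δ)`. -/
noncomputable def errorProb [Fintype 𝒜] (Ψ : SamplingStrategy 𝒜 N k τ Ω) (δ : ℝ) : ℝ :=
  ⨆ q : Fin N → 𝒜, ∑ t, if q ∉ Ψ.goodWords δ t then Ψ.prob t else 0

end SamplingStrategy

/-! ### Quantum sampling and ideal states

Each of the `N` systems `A_i B_i` has Hilbert space indexed by `α × β`.  It is sampled in an
orthonormal basis `b` of this space, indexed by the alphabet `𝒜`. -/

section Quantum

variable {𝒜 α β ε : Type*} {N : ℕ} [Fintype 𝒜] [Fintype α] [Fintype β] [Fintype ε]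

/-- Coordinates of the product vector `|q⟩ = ⨂ i, |q_i⟩` in the basis `b`, for a word `q` indexed
by an arbitrary finite set of positions. -/
noncomputable def wordVec (b : OrthonormalBasis 𝒜 ℂ (EuclideanSpace ℂ (α × β))) {ι : Type*} [Fintype ι]
    (q : ι → 𝒜) (x : ι → α × β) : ℂ :=
  ∏ i, b (q i) (x i)

/-- The space `span {|q⟩ : q ∈ G} ⊗ H_E`. -/
def wordSpace (b : OrthonormalBasis 𝒜 ℂ (EuclideanSpace ℂ (α × β))) (ε : Type*)
    (G : Set (Fin N → 𝒜)) : Submodule ℂ (((Fin N → α × β) × ε) → ℂ) :=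
  Submodule.span ℂ {v | ∃ q ∈ G, ∃ w : ε → ℂ, v = fun x => wordVec b q x.1 * w x.2}

/-- The operator `⟨q|_t ⊗ id` from `(AB)^N E` to `(AB)_{-t} E`, for a word `q` on the
positions `t`. -/
noncomputable def braOn [DecidableEq α] [DecidableEq β] [DecidableEq ε]
    (b : OrthonormalBasis 𝒜 ℂ (EuclideanSpace ℂ (α × β)))
    (t : Finset (Fin N)) (q : {i // i ∈ t} → 𝒜) :
    Matrix (({i // i ∉ t} → α × β) × ε) ((Fin N → α × β) × ε) ℂ :=
  Matrix.of fun y x =>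
    if (fun i : {i // i ∉ t} => x.1 i) = y.1 ∧ x.2 = y.2 then
      star (wordVec b q fun i => x.1 i) else 0

variable {k : ℕ} {τ Ω : Type*} [Fintype τ] [DecidableEq τ] [DecidableEq α] [DecidableEq β]
  [DecidableEq ε]

/-- `σ_{TABE} = ∑ t, P_T(t) |t⟩⟨t| ⊗ σ t` is an ideal state for
`ρ_{TABE} = ∑ t, P_T(t) |t⟩⟨t| ⊗ ρ`: each `σ t` is a state living in the space of good words, and
`½ ‖ρ_{TABE} - σ_{TABE}‖ ≤ √ε^cl_δ`. -/
def IsIdealState (Ψ : SamplingStrategy 𝒜 N k τ Ω)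
    (b : OrthonormalBasis 𝒜 ℂ (EuclideanSpace ℂ (α × β))) (δ : ℝ)
    (ρ : Matrix ((Fin N → α × β) × ε) ((Fin N → α × β) × ε) ℂ)
    (σ : τ → Matrix ((Fin N → α × β) × ε) ((Fin N → α × β) × ε) ℂ) : Prop :=
  (∀ t, 0 < Ψ.prob t → IsDensity (σ t) ∧
    ∀ v, σ t *ᵥ v ∈ wordSpace b ε (Ψ.goodWords δ t)) ∧
  (1 / 2) * traceNorm (classicalQuantum fun t => (Ψ.prob t : ℂ) • (ρ - σ t))
    ≤ Real.sqrt (Ψ.errorProb δ)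

/-! ### The protocol

A (sub-normalized) state with classical registers is given by the family of its conditional
operators, indexed by the values of the classical registers. -/

open Classical in
/-- The sampling step.  Starting from `ρ⁰_{TABE} = ∑ t, |t⟩⟨t| ⊗ ρ₀ t`, the systems in `sub t` are
measured in the basis `b` and discarded, and the outcome `s` is stored in `S`.  The result is
`ρ¹_{TSABE} = ∑ t s, |t,s⟩⟨t,s| ⊗ sampleStep t s`. -/
noncomputable def sampleStep (Ψ : SamplingStrategy 𝒜 N k τ Ω)
    (b : OrthonormalBasis 𝒜 ℂ (EuclideanSpace ℂ (α × β)))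
    (ρ₀ : τ → Matrix ((Fin N → α × β) × ε) ((Fin N → α × β) × ε) ℂ) (t : τ) (s : Ω) :
    Matrix (({i // i ∉ Ψ.sub t} → α × β) × ε) (({i // i ∉ Ψ.sub t} → α × β) × ε) ℂ :=
  ∑ q : {i // i ∈ Ψ.sub t} → 𝒜,
    if Ψ.outcome t q = s then sandwich (braOn b (Ψ.sub t) q) (ρ₀ t) else 0

open Classical in
/-- The abort map: the flag `R` is set to `1` (`true`) exactly when the outcome is not accepted. -/
noncomputable def abortStep {H : τ → Type*} (accept : Set Ω)
    (ρ₁ : (t : τ) → Ω → Matrix (H t) (H t) ℂ) (R : Bool) (t : τ) (s : Ω) :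
    Matrix (H t) (H t) ℂ :=
  if (R = true ↔ s ∉ accept) then ρ₁ t s else 0

/-- The core of a QKD protocol on top of the sampling strategy `Ψ`.

`accept` is the set `𝒮` of acceptable outcomes.  If `t`, `s` were recorded and the protocol has not
aborted, the remaining systems are subjected to a quantum instrument with classical outputs
`x y : X`, the raw keys of Alice and Bob after error correction; the system `ε'` is the adversary's
final system, including all leaked information.  The instrument is completely positive and trace
non-increasing; the missing trace is the probability of aborting at this stage. -/
structure Protocol (Ψ : SamplingStrategy 𝒜 N k τ Ω) (α β ε X ε' : Type*)
    [Fintype α] [Fintype β] [Fintype ε] [Fintype X] [Fintype ε'] where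
  accept : Set Ω
  core : (t : τ) → Ω → X → X →
    Matrix (({i // i ∉ Ψ.sub t} → α × β) × ε) (({i // i ∉ Ψ.sub t} → α × β) × ε) ℂ →ₗ[ℂ]
      Matrix ε' ε' ℂ
  core_completelyPositive : ∀ t s x y, IsCompletelyPositive (core t s x y)
  core_trace_le : ∀ t s M, M.PosSemidef → (∑ x, ∑ y, core t s x y M).trace.re ≤ M.trace.re

variable {X F ε' : Type*} [Fintype X] [Fintype F] [Fintype ε'] [Fintype Ω]

/-- The sub-normalized state `p_ok ρ*_{TSABE,R=0}` before privacy amplification: sampling, then the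
abort map, then the core protocol on the branch `R = 0`. -/
noncomputable def preKey {Ψ : SamplingStrategy 𝒜 N k τ Ω} (P : Protocol Ψ α β ε X ε')
    (b : OrthonormalBasis 𝒜 ℂ (EuclideanSpace ℂ (α × β)))
    (ρ₀ : τ → Matrix ((Fin N → α × β) × ε) ((Fin N → α × β) × ε) ℂ)
    (t : τ) (s : Ω) (x y : X) : Matrix ε' ε' ℂ :=
  P.core t s x y (abortStep P.accept (sampleStep Ψ b ρ₀) false t s)

/-- The probability `Pr (T = t, S = s, R = 0)` of not aborting, jointly with `t` and `s`. -/
noncomputable def okProbAt {Ψ : SamplingStrategy 𝒜 N k τ Ω} (P : Protocol Ψ α β ε X ε')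
    (b : OrthonormalBasis 𝒜 ℂ (EuclideanSpace ℂ (α × β)))
    (ρ₀ : τ → Matrix ((Fin N → α × β) × ε) ((Fin N → α × β) × ε) ℂ) (t : τ) (s : Ω) : ℝ :=
  (∑ x, ∑ y, preKey P b ρ₀ t s x y).trace.re

/-- The probability `p_ok` of not aborting. -/
noncomputable def okProb {Ψ : SamplingStrategy 𝒜 N k τ Ω} (P : Protocol Ψ α β ε X ε')
    (b : OrthonormalBasis 𝒜 ℂ (EuclideanSpace ℂ (α × β)))
    (ρ₀ : τ → Matrix ((Fin N → α × β) × ε) ((Fin N → α × β) × ε) ℂ) : ℝ :=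
  ∑ t, ∑ s, okProbAt P b ρ₀ t s

/-- The normalized state of Alice's raw key and `E`, conditioned on `T = t`, `S = s`, `R = 0`. -/
noncomputable def condState [DecidableEq X] {Ψ : SamplingStrategy 𝒜 N k τ Ω}
    (P : Protocol Ψ α β ε X ε') (b : OrthonormalBasis 𝒜 ℂ (EuclideanSpace ℂ (α × β)))
    (ρ₀ : τ → Matrix ((Fin N → α × β) × ε) ((Fin N → α × β) × ε) ℂ) (t : τ) (s : Ω) :
    Matrix (X × ε') (X × ε') ℂ :=
  ((okProbAt P b ρ₀ t s : ℂ))⁻¹ • classicalQuantum fun x => ∑ y, preKey P b ρ₀ t s x y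

/-- A two-universal family of hash functions from `X` to `ℓ` bits, with the distribution according
to which a function is drawn. -/
structure HashFamily (X F : Type*) [Fintype F] (ℓ : ℕ) where
  prob : F → ℝ
  prob_nonneg : ∀ f, 0 ≤ prob f
  prob_sum : ∑ f, prob f = 1
  hash : F → X → Fin ℓ → Bool
  two_universal : ∀ x x', x ≠ x' →
    (∑ f, if hash f x = hash f x' then prob f else 0) ≤ ((2 : ℝ) ^ ℓ)⁻¹

/-- Privacy amplification: a hash function `f` is drawn, stored in the public register `F`, and
applied to both raw keys, which gives the keys `u` and `v` of Alice and Bob. -/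
noncomputable def privacyAmp {ℓ : ℕ} (h : HashFamily X F ℓ)
    (ρ : τ → Ω → X → X → Matrix ε' ε' ℂ) (u v : Fin ℓ → Bool) (t : τ) (s : Ω) (f : F) :
    Matrix ε' ε' ℂ :=
  (h.prob f : ℂ) • ∑ x, ∑ y, if h.hash f x = u ∧ h.hash f y = v then ρ t s x y else 0

variable [DecidableEq Ω] [DecidableEq F]

/-- The final normalized state, conditioned on not aborting, as an operator on
`K_B ⊗ K_A ⊗ Q` with `Q = TSFE`. -/
noncomputable def finalState {Ψ : SamplingStrategy 𝒜 N k τ Ω} (P : Protocol Ψ α β ε X ε')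
    (b : OrthonormalBasis 𝒜 ℂ (EuclideanSpace ℂ (α × β))) {ℓ : ℕ} (h : HashFamily X F ℓ)
    (ρ₀ : τ → Matrix ((Fin N → α × β) × ε) ((Fin N → α × β) × ε) ℂ) :
    Matrix ((Fin ℓ → Bool) × (Fin ℓ → Bool) × (τ × Ω × F) × ε')
      ((Fin ℓ → Bool) × (Fin ℓ → Bool) × (τ × Ω × F) × ε') ℂ :=
  ((okProb P b ρ₀ : ℂ))⁻¹ • classicalQuantum fun v => classicalQuantum fun u =>
    classicalQuantum fun c : τ × Ω × F =>
      privacyAmp h (preKey P b ρ₀) u v c.1 c.2.1 c.2.2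

/-- The final state `ρ_{K_A Q}`. -/
noncomputable def keyState {Ψ : SamplingStrategy 𝒜 N k τ Ω} (P : Protocol Ψ α β ε X ε')
    (b : OrthonormalBasis 𝒜 ℂ (EuclideanSpace ℂ (α × β))) {ℓ : ℕ} (h : HashFamily X F ℓ)
    (ρ₀ : τ → Matrix ((Fin N → α × β) × ε) ((Fin N → α × β) × ε) ℂ) :
    Matrix ((Fin ℓ → Bool) × (τ × Ω × F) × ε') ((Fin ℓ → Bool) × (τ × Ω × F) × ε') ℂ :=
  traceLeft (finalState P b h ρ₀)

end Quantum

end QKD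

/-!
# Security of sampling-based quantum key distribution

*Ideal states.*  The product vectors `|q⟩` form an orthonormal basis, so the projection onto
`span {|q⟩ : q ∈ 𝒢 t} ⊗ H_E` has weight `1 - Pr (q ∉ 𝒢 t)` in `ρ`, where `q` is distributed as the
outcome of measuring `ρ` in this basis.  The normalized projection `σ t` of `ρ` satisfies
`½ ‖ρ - σ t‖ ≤ √Pr (q ∉ 𝒢 t)` (`gentle_measurement`); averaging over `t`, by concavity of the square
root, gives `√ε^cl_δ`, because the average over `q` of `Pr_t (q ∉ 𝒢 t)` is at most its maximum.  If
the projection of `ρ` vanishes, any pure state in the space serves as `σ t`, at distance at most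
`1`.

*Security.*  Sampling, the abort map and the core protocol form a linear, positive, trace
non-increasing map (`preKey_add_sub`, `preKey_posSemidef`, `sum_okProbAt_le`).  The difference of
the real and the ideal state is `A - C` with `A`, `C` positive semidefinite and
`tr A + tr C ≤ 2 √ε^cl_δ`.  As the deviation from uniform of the key is linear in the input state,
its trace norm is at most that for the ideal state plus those for `A` and `C`, and the latter two
are at most `2 tr A` and `2 tr C` (`hashDist_preKey_le`), in total `4 √ε^cl_δ`.  For the ideal state,
the leftover hash lemma (`hashDist_le_of_isDensity`) applies to each `t`, `s`.  It is proved by the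
Hilbert–Schmidt bound `‖R N R‖ ≤ √(tr R⁴) ‖N‖₂` with `R = σ^{1/4}` (`traceNorm_conj_le`) and a bound
on the collision probability (`sum_hashDev_sq_le`).

All operators involved are Hermitian, so the trace norm is only ever used through the sign of a
Hermitian matrix (`exists_sign`): `‖M‖` is the minimum of `tr A + tr B` over the decompositions
`M = A - B` into positive semidefinite matrices (`traceNorm_sub_le`, `exists_posSemidef_sub`).
-/

namespace QKD

/-! ### The trace norm of Hermitian matrices -/

section TraceNorm

variable {n : Type*} [Fintype n]

theorem trace_re_nonneg_of_posSemidef {A : Matrix n n ℂ} (hA : A.PosSemidef) : 0 ≤ A.trace.re :=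
  (Complex.le_def.1 hA.trace_nonneg).1

theorem exists_posSemidef_mul_self {A : Matrix n n ℂ} (hA : A.PosSemidef) :
    ∃ R : Matrix n n ℂ, R.PosSemidef ∧ R * R = A := by
  classical
  open scoped MatrixOrder in
  exact ⟨CFC.sqrt A, Matrix.nonneg_iff_posSemidef.1 (CFC.sqrt_nonneg A),
    CFC.sqrt_mul_sqrt_self A hA.nonneg⟩

theorem exists_eq_conjTranspose_mul_self {A : Matrix n n ℂ} (hA : A.PosSemidef) :
    ∃ R : Matrix n n ℂ, A = Rᴴ * R := by
  obtain ⟨R, hR, h⟩ := exists_posSemidef_mul_self hA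
  exact ⟨R, by rw [hR.1.eq, h]⟩

theorem trace_mul_re_nonneg_of_posSemidef {A B : Matrix n n ℂ} (hA : A.PosSemidef)
    (hB : B.PosSemidef) : 0 ≤ (A * B).trace.re := by
  obtain ⟨C, rfl⟩ := exists_eq_conjTranspose_mul_self hB
  rw [← Matrix.mul_assoc, Matrix.trace_mul_comm, ← Matrix.mul_assoc]
  exact trace_re_nonneg_of_posSemidef (hA.mul_mul_conjTranspose_same C)

variable [DecidableEq n]

theorem exists_diagonalization {M : Matrix n n ℂ} (hM : M.IsHermitian) :
    ∃ V : Matrix n n ℂ, Vᴴ * V = 1 ∧ V * Vᴴ = 1 ∧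
      M = V * Matrix.diagonal (fun i => (hM.eigenvalues i : ℂ)) * Vᴴ := by
  refine ⟨hM.eigenvectorUnitary, ?_, ?_, ?_⟩
  · simpa [Matrix.star_eq_conjTranspose] using Unitary.coe_star_mul_self hM.eigenvectorUnitary
  · simpa [Matrix.star_eq_conjTranspose] using Unitary.coe_mul_star_self hM.eigenvectorUnitary
  · have := hM.spectral_theorem
    rw [Unitary.conjStarAlgAut_apply] at this
    simpa [Matrix.star_eq_conjTranspose, Function.comp_def] using this

/-- For Hermitian `M` the eigenvalues of `M† M` are, up to order, the squares of those of `M`. -/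
theorem traceNorm_eq_sum_abs {M : Matrix n n ℂ} (hM : M.IsHermitian) :
    traceNorm M = ∑ i, |hM.eigenvalues i| := by
  have hc : (Mᴴ * M).charpoly =
      (Matrix.diagonal fun i => ((hM.eigenvalues i ^ 2 : ℝ) : ℂ)).charpoly := by
    obtain ⟨V, hVV, -, hs⟩ := exists_diagonalization hM
    have h2 : Mᴴ * M = V * (Matrix.diagonal fun i => ((hM.eigenvalues i ^ 2 : ℝ) : ℂ)) * Vᴴ := by
      rw [hM.eq]
      calc M * M = (V * Matrix.diagonal (fun i => (hM.eigenvalues i : ℂ)) * Vᴴ) *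
            (V * Matrix.diagonal (fun i => (hM.eigenvalues i : ℂ)) * Vᴴ) := by rw [← hs]
        _ = V * (Matrix.diagonal (fun i => (hM.eigenvalues i : ℂ)) * (Vᴴ * V) *
            Matrix.diagonal (fun i => (hM.eigenvalues i : ℂ))) * Vᴴ := by
              simp only [Matrix.mul_assoc]
        _ = _ := by
              rw [hVV, Matrix.mul_one, Matrix.diagonal_mul_diagonal]
              simp [sq]
    rw [h2, Matrix.charpoly_mul_comm, ← Matrix.mul_assoc, hVV, Matrix.one_mul]
  have hr := congrArg Polynomial.roots hc
  rw [(Matrix.isHermitian_conjTranspose_mul_self M).roots_charpoly_eq_eigenvalues,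
    Matrix.charpoly_diagonal] at hr
  have hroots := Polynomial.roots_multiset_prod_X_sub_C
    (Finset.univ.val.map fun i => ((hM.eigenvalues i ^ 2 : ℝ) : ℂ))
  rw [Multiset.map_map] at hroots
  replace hr := hr.trans hroots
  have := congrArg (fun s : Multiset ℂ => (s.map fun z => Real.sqrt z.re).sum) hr
  simp only [Multiset.map_map, Function.comp_def, Complex.ofReal_re, Real.sqrt_sq_eq_abs] at this
  exact this

/-- A Hermitian matrix has a Hermitian unitary sign `U`: `U M = |M|`. -/
theorem exists_sign {M : Matrix n n ℂ} (hM : M.IsHermitian) :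
    ∃ U : Matrix n n ℂ, U.IsHermitian ∧ U * U = 1 ∧ (U * M + M).PosSemidef ∧
      (U * M - M).PosSemidef ∧ traceNorm M = (U * M).trace.re := by
  obtain ⟨V, hVV, hVV', hs⟩ := exists_diagonalization hM
  set d := hM.eigenvalues with hd
  have key : ∀ a c : n → ℂ, (V * Matrix.diagonal a * Vᴴ) * (V * Matrix.diagonal c * Vᴴ) =
      V * Matrix.diagonal (fun i => a i * c i) * Vᴴ := fun a c => by
    calc _ = V * (Matrix.diagonal a * (Vᴴ * V) * Matrix.diagonal c) * Vᴴ := by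
          simp only [Matrix.mul_assoc]
      _ = _ := by rw [hVV, Matrix.mul_one, Matrix.diagonal_mul_diagonal]
  let g : n → ℂ := fun i => if 0 ≤ d i then 1 else -1
  have hg : ∀ i, g i * g i = 1 := fun i => by simp only [g]; split_ifs <;> simp
  have hgd : ∀ i, g i * d i = (|d i| : ℝ) := fun i => by
    simp only [g]
    split_ifs with h
    · rw [abs_of_nonneg h, one_mul]
    · rw [abs_of_neg (not_le.1 h)]; simp
  have hUM : (V * Matrix.diagonal g * Vᴴ) * M =
      V * Matrix.diagonal (fun i => ((|d i| : ℝ) : ℂ)) * Vᴴ := by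
    conv_lhs => rw [hs]
    rw [key]; simp only [hgd]
  refine ⟨V * Matrix.diagonal g * Vᴴ, ?_, ?_, ?_, ?_, ?_⟩
  · have : star g = g := by
      funext i; simp only [g, Pi.star_apply]; split_ifs <;> simp
    simp [Matrix.IsHermitian, Matrix.conjTranspose_mul, Matrix.diagonal_conjTranspose, this,
      Matrix.mul_assoc]
  · rw [key]; simp [hg, hVV']
  · rw [hUM]
    nth_rewrite 1 [hs]
    rw [← Matrix.add_mul, ← Matrix.mul_add, Matrix.diagonal_add]
    refine (Matrix.PosSemidef.diagonal fun i => ?_).mul_mul_conjTranspose_same V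
    have : 0 ≤ |d i| + d i := by linarith [neg_abs_le (d i)]
    simpa using (show (0 : ℂ) ≤ ((|d i| + d i : ℝ) : ℂ) by exact_mod_cast this)
  · rw [hUM]
    nth_rewrite 1 [hs]
    rw [← Matrix.sub_mul, ← Matrix.mul_sub, Matrix.diagonal_sub]
    refine (Matrix.PosSemidef.diagonal fun i => ?_).mul_mul_conjTranspose_same V
    have : 0 ≤ |d i| - d i := by linarith [le_abs_self (d i)]
    simpa using (show (0 : ℂ) ≤ ((|d i| - d i : ℝ) : ℂ) by exact_mod_cast this)
  · rw [hUM, traceNorm_eq_sum_abs hM, Matrix.trace_mul_comm, ← Matrix.mul_assoc, hVV,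
      Matrix.one_mul, Matrix.trace_diagonal]
    simp [hd]

/-- The positive and negative parts of a Hermitian matrix. -/
theorem exists_posSemidef_sub {M : Matrix n n ℂ} (hM : M.IsHermitian) :
    ∃ A B : Matrix n n ℂ, A.PosSemidef ∧ B.PosSemidef ∧ M = A - B ∧
      traceNorm M = A.trace.re + B.trace.re := by
  obtain ⟨U, -, -, h1, h2, h3⟩ := exists_sign hM
  have hhalf : (0 : ℂ) ≤ 1 / 2 := by
    rw [show (1 / 2 : ℂ) = ((1 / 2 : ℝ) : ℂ) by push_cast; rfl]
    exact_mod_cast (by norm_num : (0 : ℝ) ≤ 1 / 2)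
  refine ⟨(1 / 2 : ℂ) • (U * M + M), (1 / 2 : ℂ) • (U * M - M), h1.smul hhalf, h2.smul hhalf,
    ?_, ?_⟩
  · rw [← smul_sub, add_sub_sub_cancel, ← two_smul ℂ M, smul_smul]; norm_num
  · rw [h3]
    simp [Matrix.trace_add, Matrix.trace_sub, Matrix.trace_smul]
    ring

theorem trace_mul_le_of_involution {U A : Matrix n n ℂ} (hU : U.IsHermitian) (hUU : U * U = 1)
    (hA : A.PosSemidef) : |(U * A).trace.re| ≤ A.trace.re := by
  -- `1 ± U` is positive semidefinite because `(1 ± U)² = 2 (1 ± U)`.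
  have h1 : 0 ≤ (((1 - U)ᴴ * (1 - U)) * A).trace.re :=
    trace_mul_re_nonneg_of_posSemidef (Matrix.posSemidef_conjTranspose_mul_self _) hA
  have h2 : 0 ≤ (((1 + U)ᴴ * (1 + U)) * A).trace.re :=
    trace_mul_re_nonneg_of_posSemidef (Matrix.posSemidef_conjTranspose_mul_self _) hA
  have e1 : (1 - U)ᴴ * (1 - U) = (2 : ℂ) • (1 - U) := by
    rw [Matrix.conjTranspose_sub, hU.eq, Matrix.conjTranspose_one, sub_mul, mul_sub, mul_sub, hUU,
      two_smul]; simp; abel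
  have e2 : (1 + U)ᴴ * (1 + U) = (2 : ℂ) • (1 + U) := by
    rw [Matrix.conjTranspose_add, hU.eq, Matrix.conjTranspose_one, add_mul, mul_add, mul_add, hUU,
      two_smul]; simp; abel
  rw [e1] at h1
  rw [e2] at h2
  simp [sub_mul, add_mul, Matrix.trace_sub, Matrix.trace_add] at h1 h2
  rw [abs_le]; constructor <;> linarith

theorem traceNorm_sub_le {A B : Matrix n n ℂ} (hA : A.PosSemidef) (hB : B.PosSemidef) :
    traceNorm (A - B) ≤ A.trace.re + B.trace.re := by
  obtain ⟨U, hU, hUU, -, -, h3⟩ := exists_sign (hA.1.sub hB.1)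
  rw [h3, mul_sub, Matrix.trace_sub, Complex.sub_re]
  linarith [(abs_le.1 (trace_mul_le_of_involution hU hUU hA)).2,
    (abs_le.1 (trace_mul_le_of_involution hU hUU hB)).1]

theorem traceNorm_nonneg (M : Matrix n n ℂ) : 0 ≤ traceNorm M :=
  Finset.sum_nonneg fun _ _ => Real.sqrt_nonneg _

theorem traceNorm_add_le {M N : Matrix n n ℂ} (hM : M.IsHermitian) (hN : N.IsHermitian) :
    traceNorm (M + N) ≤ traceNorm M + traceNorm N := by
  obtain ⟨A, B, hA, hB, rfl, h⟩ := exists_posSemidef_sub hM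
  obtain ⟨C, D, hC, hD, rfl, h'⟩ := exists_posSemidef_sub hN
  rw [h, h', sub_add_sub_comm]
  refine (traceNorm_sub_le (hA.add hC) (hB.add hD)).trans_eq ?_
  simp only [Matrix.trace_add, Complex.add_re]; ring

theorem traceNorm_sub_le_add {M N : Matrix n n ℂ} (hM : M.IsHermitian) (hN : N.IsHermitian) :
    traceNorm (M - N) ≤ traceNorm M + traceNorm N := by
  obtain ⟨A, B, hA, hB, rfl, h⟩ := exists_posSemidef_sub hM
  obtain ⟨C, D, hC, hD, rfl, h'⟩ := exists_posSemidef_sub hN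
  rw [h, h', sub_sub_sub_comm, show A - C - (B - D) = (A + D) - (B + C) by abel]
  refine (traceNorm_sub_le (hA.add hD) (hB.add hC)).trans_eq ?_
  simp only [Matrix.trace_add, Complex.add_re]; ring

theorem traceNorm_smul_le {M : Matrix n n ℂ} (hM : M.IsHermitian) {c : ℝ} (hc : 0 ≤ c) :
    traceNorm ((c : ℂ) • M) ≤ c * traceNorm M := by
  obtain ⟨A, B, hA, hB, rfl, h⟩ := exists_posSemidef_sub hM
  have hc' : (0 : ℂ) ≤ c := by exact_mod_cast hc
  rw [h, smul_sub]
  refine (traceNorm_sub_le (hA.smul hc') (hB.smul hc')).trans_eq ?_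
  simp [Matrix.trace_smul]; ring

end TraceNorm

/-! ### Classical-quantum operators -/

section ClassicalQuantum

theorem traceLeft_smul {n m : Type*} [Fintype n] (a : ℂ) (M : Matrix (n × m) (n × m) ℂ) :
    traceLeft (a • M) = a • traceLeft M := by
  ext i j
  simp [traceLeft, Finset.mul_sum]

variable {n m : Type*} [Fintype n] [DecidableEq n]

theorem classicalQuantum_apply (B : n → Matrix m m ℂ) (c c' : n) (i j : m) :
    classicalQuantum B (c, i) (c', j) = if c = c' then B c i j else 0 := by
  simp only [classicalQuantum, Matrix.sum_apply, Matrix.kroneckerMap_apply, Matrix.single_apply]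
  by_cases h : c = c'
  · subst h
    simp
  · rw [if_neg h]
    refine Finset.sum_eq_zero fun k _ => ?_
    rw [if_neg (by rintro ⟨rfl, rfl⟩; exact h rfl), zero_mul]

theorem classicalQuantum_posSemidef [Fintype m] {B : n → Matrix m m ℂ}
    (hB : ∀ c, (B c).PosSemidef) :
    (classicalQuantum B).PosSemidef := by
  refine Matrix.posSemidef_sum _ fun c _ => Matrix.PosSemidef.kronecker ?_ (hB c)
  rw [← Matrix.diagonal_single]
  refine Matrix.PosSemidef.diagonal fun i => ?_
  by_cases h : i = c
  · subst h; simp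
  · simp [h]

theorem classicalQuantum_isHermitian {B : n → Matrix m m ℂ} (hB : ∀ c, (B c).IsHermitian) :
    (classicalQuantum B).IsHermitian := by
  ext ⟨c, i⟩ ⟨c', j⟩
  rw [Matrix.conjTranspose_apply, classicalQuantum_apply, classicalQuantum_apply]
  by_cases h : c = c'
  · subst h
    simpa using congrFun (congrFun (hB c) i) j
  · simp [h, Ne.symm h]

theorem classicalQuantum_sub (A B : n → Matrix m m ℂ) :
    classicalQuantum A - classicalQuantum B = classicalQuantum fun c => A c - B c := by
  ext ⟨c, i⟩ ⟨c', j⟩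
  simp only [Matrix.sub_apply, classicalQuantum_apply]
  split_ifs <;> simp

theorem classicalQuantum_smul (a : ℂ) (B : n → Matrix m m ℂ) :
    a • classicalQuantum B = classicalQuantum fun c => a • B c := by
  ext ⟨c, i⟩ ⟨c', j⟩
  simp [classicalQuantum_apply]

theorem classicalQuantum_sum {κ : Type*} [Fintype κ] (B : κ → n → Matrix m m ℂ) :
    ∑ k, classicalQuantum (B k) = classicalQuantum fun c => ∑ k, B k c := by
  ext ⟨c, i⟩ ⟨c', j⟩
  simp only [Matrix.sum_apply, classicalQuantum_apply]
  split_ifs <;> simp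

theorem trace_classicalQuantum [Fintype m] (B : n → Matrix m m ℂ) :
    (classicalQuantum B).trace = ∑ c, (B c).trace := by
  simp [Matrix.trace, Fintype.sum_prod_type, classicalQuantum_apply]

theorem traceLeft_classicalQuantum (B : n → Matrix m m ℂ) :
    traceLeft (classicalQuantum B) = ∑ c, B c := by
  ext i j
  simp [traceLeft, classicalQuantum_apply, Matrix.sum_apply]

theorem uniformBits_kronecker (ℓ : ℕ) (M : Matrix m m ℂ) :
    uniformBits ℓ ⊗ₖ M = classicalQuantum fun _ => ((2 : ℂ) ^ ℓ)⁻¹ • M := by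
  ext ⟨c, i⟩ ⟨c', j⟩
  rw [classicalQuantum_apply]
  by_cases h : c = c'
  · subst h; simp [uniformBits, Matrix.kroneckerMap_apply]
  · simp [uniformBits, Matrix.kroneckerMap_apply, h]

theorem traceNorm_classicalQuantum_le [Fintype m] [DecidableEq m] {B : n → Matrix m m ℂ}
    (hB : ∀ c, (B c).IsHermitian) :
    traceNorm (classicalQuantum B) ≤ ∑ c, traceNorm (B c) := by
  choose A C hA hC hAC h using fun c => exists_posSemidef_sub (hB c)
  rw [show B = fun c => A c - C c from funext hAC, ← classicalQuantum_sub]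
  refine (traceNorm_sub_le (classicalQuantum_posSemidef hA)
    (classicalQuantum_posSemidef hC)).trans_eq ?_
  simp only [← hAC, h, trace_classicalQuantum, Complex.re_sum, Finset.sum_add_distrib]

/-- The diagonal blocks of a positive and a negative part split a block diagonal operator
blockwise. -/
theorem exists_posSemidef_sub_blocks [Fintype m] [DecidableEq m] {B : n → Matrix m m ℂ}
    (hB : ∀ c, (B c).IsHermitian) :
    ∃ A C : n → Matrix m m ℂ, (∀ c, (A c).PosSemidef) ∧ (∀ c, (C c).PosSemidef) ∧
      (∀ c, B c = A c - C c) ∧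
      traceNorm (classicalQuantum B) = ∑ c, (A c).trace.re + ∑ c, (C c).trace.re := by
  obtain ⟨A, C, hA, hC, h, hn⟩ := exists_posSemidef_sub (classicalQuantum_isHermitian hB)
  refine ⟨fun c => A.submatrix (Prod.mk c) (Prod.mk c),
    fun c => C.submatrix (Prod.mk c) (Prod.mk c),
    fun c => hA.submatrix _, fun c => hC.submatrix _, fun c => ?_, ?_⟩
  · ext i j
    have := congrFun (congrFun h (c, i)) (c, j)
    rw [classicalQuantum_apply, if_pos rfl] at this
    simpa using this
  · rw [hn]
    simp [Matrix.trace, Fintype.sum_prod_type]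

end ClassicalQuantum

/-! ### The Hilbert–Schmidt inner product -/

section HilbertSchmidt

variable {n m : Type*} [Fintype n] [Fintype m]

/-- The Cauchy–Schwarz inequality for the Hilbert–Schmidt inner product. -/
theorem re_trace_conjTranspose_mul_le (A B : Matrix m n ℂ) :
    (Aᴴ * B).trace.re ≤ √(Aᴴ * A).trace.re * √(Bᴴ * B).trace.re := by
  have h1 : ∀ C : Matrix m n ℂ, (Cᴴ * C).trace.re = ∑ p : n × m, ‖C p.2 p.1‖ ^ 2 := fun C => by
    simp [Matrix.trace, Matrix.mul_apply, Fintype.sum_prod_type, ← Complex.normSq_eq_norm_sq,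
      Complex.normSq_apply]
  rw [h1, h1]
  refine le_trans ?_ (Real.sum_mul_le_sqrt_mul_sqrt _ _ _)
  simp only [Matrix.trace, Matrix.mul_apply, Matrix.diag_apply, Complex.re_sum,
    Fintype.sum_prod_type, Matrix.conjTranspose_apply]
  refine Finset.sum_le_sum fun i _ => Finset.sum_le_sum fun j _ => ?_
  refine (Complex.re_le_norm _).trans ?_
  simp

variable [DecidableEq n]

/-- Twice `W W† - V V†` is `(W - V) (W + V)† + (W + V) (W - V)†`, and the trace norm of a product is
at most the product of the Hilbert–Schmidt norms. -/
theorem traceNorm_mul_conjTranspose_sub_le (W V : Matrix n m ℂ) :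
    traceNorm (W * Wᴴ - V * Vᴴ) ≤
      √((W - V)ᴴ * (W - V)).trace.re * √((W + V)ᴴ * (W + V)).trace.re := by
  obtain ⟨U, hU, hUU, -, -, h⟩ := exists_sign
    ((Matrix.isHermitian_mul_conjTranspose_self W).sub
      (Matrix.isHermitian_mul_conjTranspose_self V))
  have hunit : ∀ C : Matrix n m ℂ, ((U * C)ᴴ * (U * C)) = Cᴴ * C := fun C => by
    rw [Matrix.conjTranspose_mul, hU.eq, Matrix.mul_assoc, ← Matrix.mul_assoc U, hUU,
      Matrix.one_mul]
  have e : (U * (W * Wᴴ - V * Vᴴ)).trace.re =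
      (((W + V)ᴴ * (U * (W - V))).trace.re + ((W - V)ᴴ * (U * (W + V))).trace.re) / 2 := by
    rw [Matrix.trace_mul_comm (W + V)ᴴ, Matrix.trace_mul_comm (W - V)ᴴ, ← Complex.add_re,
      ← Matrix.trace_add, Matrix.mul_assoc, Matrix.mul_assoc, ← Matrix.mul_add]
    have : (W - V) * (W + V)ᴴ + (W + V) * (W - V)ᴴ = (2 : ℂ) • (W * Wᴴ - V * Vᴴ) := by
      rw [Matrix.conjTranspose_add, Matrix.conjTranspose_sub, two_smul]
      simp only [Matrix.sub_mul, Matrix.add_mul, Matrix.mul_add, Matrix.mul_sub]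
      abel
    rw [this, Matrix.mul_smul, Matrix.trace_smul]
    simp
  have h1 := re_trace_conjTranspose_mul_le (W + V) (U * (W - V))
  have h2 := re_trace_conjTranspose_mul_le (W - V) (U * (W + V))
  rw [hunit] at h1 h2
  rw [h, e]
  linarith [mul_comm (√((W - V)ᴴ * (W - V)).trace.re) (√((W + V)ᴴ * (W + V)).trace.re)]

/-- If `U` is the sign of `R N R`, then `‖R N R‖ = tr ((R U R) N) ≤ ‖R U R‖₂ ‖N‖₂`, and
`‖R U R‖₂²` is the Hilbert–Schmidt inner product of `R²` and `U R² U`, hence at most `tr R⁴`. -/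
theorem traceNorm_conj_le {R N : Matrix n n ℂ} (hR : R.IsHermitian) (hN : N.IsHermitian) :
    traceNorm (R * N * R) ≤ √(R * R * (R * R)).trace.re * √(N * N).trace.re := by
  have hRNR : (R * N * R).IsHermitian := by
    simp [Matrix.IsHermitian, hR.eq, hN.eq, Matrix.mul_assoc]
  obtain ⟨U, hU, hUU, -, -, h⟩ := exists_sign hRNR
  have hS : (R * U * R).IsHermitian := by
    simp [Matrix.IsHermitian, hR.eq, hU.eq, Matrix.mul_assoc]
  have e1 : (U * (R * N * R)).trace = ((R * U * R)ᴴ * N).trace := by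
    rw [hS.eq, Matrix.trace_mul_comm, Matrix.mul_assoc, Matrix.mul_assoc, Matrix.trace_mul_comm,
      Matrix.mul_assoc, Matrix.trace_mul_comm]
  have e2 : ((R * U * R)ᴴ * (R * U * R)).trace = ((R * R)ᴴ * (U * (R * R) * U)).trace := by
    rw [hS.eq, Matrix.conjTranspose_mul, hR.eq]
    calc (R * U * R * (R * U * R)).trace = (R * (U * R * R * U * R)).trace := by
          simp only [Matrix.mul_assoc]
      _ = ((U * R * R * U * R) * R).trace := Matrix.trace_mul_comm _ _
      _ = ((U * R * R * U) * (R * R)).trace := by simp only [Matrix.mul_assoc]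
      _ = ((R * R) * (U * R * R * U)).trace := Matrix.trace_mul_comm _ _
      _ = _ := by simp only [Matrix.mul_assoc]
  have e3 : ((U * (R * R) * U)ᴴ * (U * (R * R) * U)).trace = (R * R * (R * R)).trace := by
    simp only [Matrix.conjTranspose_mul, hR.eq, hU.eq]
    calc (U * (R * R * U) * (U * (R * R) * U)).trace
        = (U * ((R * R) * (U * U) * (R * R) * U)).trace := by simp only [Matrix.mul_assoc]
      _ = (((R * R) * (U * U) * (R * R) * U) * U).trace := Matrix.trace_mul_comm _ _
      _ = ((R * R) * (U * U) * (R * R) * (U * U)).trace := by simp only [Matrix.mul_assoc]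
      _ = _ := by rw [hUU]; simp
  have e4 : (R * R)ᴴ * (R * R) = R * R * (R * R) := by
    rw [Matrix.conjTranspose_mul, hR.eq]
  have h0 : 0 ≤ (R * R * (R * R)).trace.re := by
    rw [← e4]; exact trace_re_nonneg_of_posSemidef (Matrix.posSemidef_conjTranspose_mul_self _)
  have h2 := re_trace_conjTranspose_mul_le (R * R) (U * (R * R) * U)
  rw [e3, ← e2, e4, Real.mul_self_sqrt h0] at h2
  have h1 := re_trace_conjTranspose_mul_le (R * U * R) N
  rw [← e1, ← h, hN.eq] at h1
  exact h1.trans (mul_le_mul_of_nonneg_right (Real.sqrt_le_sqrt h2) (Real.sqrt_nonneg _))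

end HilbertSchmidt

/-! ### Privacy amplification -/

section LeftoverHash

variable {X F n : Type*} [Fintype X] [Fintype F] {ℓ : ℕ}

/-- The deviation of the hash value `u` of `f` from uniform: for `r = ∑ x, |x⟩⟨x| ⊗ r x` it is the
block `⟨u| f(r) |u⟩ - 2^{-ℓ} tr_X r`. -/
noncomputable def hashDev (h : HashFamily X F ℓ) (r : X → Matrix n n ℂ) (f : F)
    (u : Fin ℓ → Bool) : Matrix n n ℂ :=
  (∑ x, if h.hash f x = u then r x else 0) - ((2 : ℂ) ^ ℓ)⁻¹ • ∑ x, r x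

theorem hashDev_eq_sum (h : HashFamily X F ℓ) (r : X → Matrix n n ℂ) (f : F) (u : Fin ℓ → Bool) :
    hashDev h r f u =
      ∑ x, (((if h.hash f x = u then 1 else 0) - ((2 : ℝ) ^ ℓ)⁻¹ : ℝ) : ℂ) • r x := by
  rw [hashDev, Finset.smul_sum, ← Finset.sum_sub_distrib]
  refine Finset.sum_congr rfl fun x _ => ?_
  push_cast
  rw [sub_smul]
  split_ifs <;> simp

theorem hashDev_add (h : HashFamily X F ℓ) (r r' : X → Matrix n n ℂ) (f : F) (u : Fin ℓ → Bool) :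
    hashDev h (fun x => r x + r' x) f u = hashDev h r f u + hashDev h r' f u := by
  simp only [hashDev_eq_sum, smul_add, Finset.sum_add_distrib]

theorem hashDev_sub (h : HashFamily X F ℓ) (r r' : X → Matrix n n ℂ) (f : F) (u : Fin ℓ → Bool) :
    hashDev h (fun x => r x - r' x) f u = hashDev h r f u - hashDev h r' f u := by
  simp only [hashDev_eq_sum, smul_sub, Finset.sum_sub_distrib]

theorem hashDev_isHermitian (h : HashFamily X F ℓ) {r : X → Matrix n n ℂ}
    (hr : ∀ x, (r x).IsHermitian) (f : F) (u : Fin ℓ → Bool) :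
    (hashDev h r f u).IsHermitian := by
  rw [hashDev_eq_sum]
  simp [Matrix.IsHermitian, Matrix.conjTranspose_sum, Matrix.conjTranspose_smul, fun x => (hr x).eq]

variable [Fintype n]

/-- The collision bound: averaged over the two-universal family, the off-diagonal terms
`tr (M x M x')`, which are nonnegative, contribute at most `0`. -/
theorem sum_hashDev_sq_le [DecidableEq X] (h : HashFamily X F ℓ) {M : X → Matrix n n ℂ}
    (hM : ∀ x, (M x).PosSemidef) :
    ∑ f, h.prob f * ∑ u, (hashDev h M f u * hashDev h M f u).trace.re ≤
      ∑ x, (M x * M x).trace.re := by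
  set e : ℝ := ((2 : ℝ) ^ ℓ)⁻¹ with he
  have he0 : 0 ≤ e := by positivity
  have hcard : (Fintype.card (Fin ℓ → Bool) : ℝ) * e = 1 := by simp [e]
  let T : X → X → ℝ := fun x x' => (M x * M x').trace.re
  have hT : ∀ x x', 0 ≤ T x x' := fun x x' => trace_mul_re_nonneg_of_posSemidef (hM x) (hM x')
  have hu : ∀ f, ∑ u, (hashDev h M f u * hashDev h M f u).trace.re =
      ∑ x, ∑ x', ((if h.hash f x = h.hash f x' then 1 else 0) - e) * T x x' := fun f => by
    have hexp : ∀ u, (hashDev h M f u * hashDev h M f u).trace.re = ∑ x, ∑ x',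
        (((if h.hash f x = u then 1 else 0) - e) * ((if h.hash f x' = u then 1 else 0) - e)) *
          T x x' := fun u => by
      rw [hashDev_eq_sum, Finset.sum_mul_sum, Matrix.trace_sum, Complex.re_sum]
      refine Finset.sum_congr rfl fun x _ => ?_
      rw [Matrix.trace_sum, Complex.re_sum]
      refine Finset.sum_congr rfl fun x' _ => ?_
      rw [Matrix.smul_mul, Matrix.mul_smul, smul_smul, Matrix.trace_smul, ← Complex.ofReal_mul,
        smul_eq_mul, Complex.re_ofReal_mul]
    simp only [hexp]
    rw [Finset.sum_comm]
    refine Finset.sum_congr rfl fun x _ => ?_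
    rw [Finset.sum_comm]
    refine Finset.sum_congr rfl fun x' _ => ?_
    rw [← Finset.sum_mul]
    congr 1
    have : ∀ u : Fin ℓ → Bool,
        ((if h.hash f x = u then 1 else 0) - e) * ((if h.hash f x' = u then 1 else 0) - e) =
        (if h.hash f x = u then (if h.hash f x' = u then 1 else 0) else 0) -
          e * (if h.hash f x = u then 1 else 0) - e * (if h.hash f x' = u then 1 else 0) +
          e * e := fun u => by split_ifs <;> ring
    simp only [this, Finset.sum_add_distrib, Finset.sum_sub_distrib, ← Finset.mul_sum,
      Finset.sum_ite_eq, Finset.mem_univ, if_true, Finset.sum_const, Finset.card_univ,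
      nsmul_eq_mul, hcard]
    simp only [eq_comm (a := h.hash f x')]
    ring
  simp only [hu, Finset.mul_sum]
  rw [Finset.sum_comm]
  refine Finset.sum_le_sum fun x _ => ?_
  rw [Finset.sum_comm]
  have hx : ∀ x', ∑ f, h.prob f * (((if h.hash f x = h.hash f x' then 1 else 0) - e) * T x x') ≤
      if x' = x then T x x else 0 := fun x' => by
    have h1 : ∑ f, h.prob f * (((if h.hash f x = h.hash f x' then 1 else 0) - e) * T x x') =
        ((∑ f, if h.hash f x = h.hash f x' then h.prob f else 0) - e) * T x x' := by
      have : (∑ f, if h.hash f x = h.hash f x' then h.prob f else 0) - e =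
          ∑ f, h.prob f * ((if h.hash f x = h.hash f x' then 1 else 0) - e) := by
        simp only [mul_sub, Finset.sum_sub_distrib, ← Finset.sum_mul, h.prob_sum, one_mul,
          mul_ite, mul_one, mul_zero]
      rw [this, Finset.sum_mul]
      exact Finset.sum_congr rfl fun f _ => by ring
    rw [h1]
    split_ifs with hxx
    · subst hxx
      simp only [if_true, h.prob_sum]
      nlinarith [hT x' x']
    · exact mul_nonpos_of_nonpos_of_nonneg
        (sub_nonpos.2 (h.two_universal x x' (Ne.symm hxx))) (hT x x')
  exact (Finset.sum_le_sum fun x' _ => hx x').trans_eq (by simp [T])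

variable [DecidableEq n]

/-- The expected distance from uniform of the key obtained from the raw key `r`. -/
noncomputable def hashDist (h : HashFamily X F ℓ) (r : X → Matrix n n ℂ) : ℝ :=
  ∑ f, h.prob f * ∑ u, traceNorm (hashDev h r f u)

theorem hashDist_add_sub_le (h : HashFamily X F ℓ) {r a c : X → Matrix n n ℂ}
    (hr : ∀ x, (r x).IsHermitian) (ha : ∀ x, (a x).IsHermitian) (hc : ∀ x, (c x).IsHermitian) :
    hashDist h (fun x => r x + (a x - c x)) ≤ hashDist h r + (hashDist h a + hashDist h c) := by
  simp only [hashDist, ← Finset.sum_add_distrib, ← mul_add]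
  refine Finset.sum_le_sum fun f _ =>
    mul_le_mul_of_nonneg_left (Finset.sum_le_sum fun u _ => ?_) (h.prob_nonneg f)
  rw [hashDev_add, hashDev_sub]
  have hA := hashDev_isHermitian h ha f u
  have hC := hashDev_isHermitian h hc f u
  exact (traceNorm_add_le (hashDev_isHermitian h hr f u) (hA.sub hC)).trans
    (by linarith [traceNorm_sub_le_add hA hC])

theorem hashDist_le_two_mul_trace (h : HashFamily X F ℓ) {r : X → Matrix n n ℂ}
    (hr : ∀ x, (r x).PosSemidef) : hashDist h r ≤ 2 * (∑ x, r x).trace.re := by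
  have hf : ∀ f, ∑ u, traceNorm (hashDev h r f u) ≤ 2 * (∑ x, r x).trace.re := fun f => by
    have hsum : (∑ x, r x).PosSemidef := Matrix.posSemidef_sum _ fun x _ => hr x
    have hinv : (0 : ℂ) ≤ ((2 : ℂ) ^ ℓ)⁻¹ := by
      rw [show ((2 : ℂ) ^ ℓ)⁻¹ = ((((2 : ℝ) ^ ℓ)⁻¹ : ℝ) : ℂ) by push_cast; rfl]
      exact_mod_cast (by positivity : (0 : ℝ) ≤ ((2 : ℝ) ^ ℓ)⁻¹)
    calc ∑ u, traceNorm (hashDev h r f u)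
        ≤ ∑ u, ((∑ x, if h.hash f x = u then r x else 0).trace.re +
            (((2 : ℂ) ^ ℓ)⁻¹ • ∑ x, r x).trace.re) := by
          refine Finset.sum_le_sum fun u _ => traceNorm_sub_le ?_ (hsum.smul hinv)
          refine Matrix.posSemidef_sum _ fun x _ => ?_
          split_ifs
          exacts [hr x, Matrix.PosSemidef.zero]
      _ = (∑ u, ∑ x, if h.hash f x = u then r x else 0).trace.re +
            (∑ _u : Fin ℓ → Bool, ((2 : ℂ) ^ ℓ)⁻¹ • ∑ x, r x).trace.re := by
          rw [Finset.sum_add_distrib, Matrix.trace_sum, Matrix.trace_sum, Complex.re_sum,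
            Complex.re_sum]
      _ = 2 * (∑ x, r x).trace.re := by
          rw [Finset.sum_comm]
          have : ∀ M : Matrix n n ℂ, ∑ _u : Fin ℓ → Bool, ((2 : ℂ) ^ ℓ)⁻¹ • M = M := fun M => by
            rw [Finset.sum_const, ← Nat.cast_smul_eq_nsmul ℂ, smul_smul]
            simp
          rw [this]
          simp only [Finset.sum_ite_eq, Finset.mem_univ, if_true]
          ring
  calc hashDist h r ≤ ∑ f, h.prob f * (2 * (∑ x, r x).trace.re) :=
        Finset.sum_le_sum fun f _ => mul_le_mul_of_nonneg_left (hf f) (h.prob_nonneg f)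
    _ = _ := by rw [← Finset.sum_mul, h.prob_sum, one_mul]

/-- The leftover hash lemma relative to a positive definite operator `σ` on the adversary's
system. -/
theorem hashDist_le_of_posDef [DecidableEq X] (h : HashFamily X F ℓ) {r : X → Matrix n n ℂ}
    (hr : ∀ x, (r x).PosSemidef) {σ : Matrix n n ℂ} (hσ : σ.PosDef) {c : ℝ}
    (hc : ∀ x, ((c : ℂ) • σ - r x).PosSemidef) :
    hashDist h r ≤ √(σ.trace.re * (2 ^ ℓ * (c * (∑ x, r x).trace.re))) := by
  obtain ⟨S, hS, hSS⟩ := exists_posSemidef_mul_self hσ.posSemidef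
  obtain ⟨R, hR, hRR⟩ := exists_posSemidef_mul_self hS
  have hdet : IsUnit R.det := by
    have hu : IsUnit σ.det := (Matrix.isUnit_iff_isUnit_det _).1 hσ.isUnit
    rw [← hSS, ← hRR, Matrix.det_mul, Matrix.det_mul] at hu
    exact isUnit_of_mul_isUnit_left (isUnit_of_mul_isUnit_left hu)
  have hRi : R * R⁻¹ = 1 := Matrix.mul_nonsing_inv _ hdet
  have hiR : R⁻¹ * R = 1 := Matrix.nonsing_inv_mul _ hdet
  have hiH : (R⁻¹)ᴴ = R⁻¹ := by rw [Matrix.conjTranspose_nonsing_inv, hR.1.eq]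
  let M : X → Matrix n n ℂ := fun x => R⁻¹ * r x * R⁻¹
  have hM : ∀ x, (M x).PosSemidef := fun x => by
    have := (hr x).mul_mul_conjTranspose_same R⁻¹
    rwa [hiH] at this
  have hrM : ∀ x, r x = R * M x * R := fun x => by
    simp only [M]
    calc r x = (R * R⁻¹) * r x * (R⁻¹ * R) := by rw [hRi, hiR]; simp
      _ = _ := by simp only [Matrix.mul_assoc]
  have hdev : ∀ f u, hashDev h r f u = R * hashDev h M f u * R := fun f u => by
    simp only [hashDev_eq_sum, Finset.mul_sum, Finset.sum_mul, Matrix.mul_smul, Matrix.smul_mul,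
      ← hrM]
  -- `M x ≤ c R²`, hence `tr (M x)² ≤ c tr (M x R²) = c tr (r x)`.
  have hMM : ∀ x, (M x * M x).trace.re ≤ c * (r x).trace.re := fun x => by
    have h1 : ((c : ℂ) • (R * R) - M x).PosSemidef := by
      have := (hc x).mul_mul_conjTranspose_same R⁻¹
      rw [hiH, mul_sub, sub_mul] at this
      convert this using 2
      rw [← hSS, ← hRR, Matrix.mul_smul, Matrix.smul_mul]
      congr 1
      calc R * R = (R⁻¹ * R) * R * R * (R * R⁻¹) := by rw [hiR, hRi]; simp
        _ = _ := by simp only [Matrix.mul_assoc]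
    have h2 := trace_mul_re_nonneg_of_posSemidef (hM x) h1
    have h3 : (M x * (R * R)).trace = (r x).trace := by
      rw [hrM x, Matrix.trace_mul_comm (M x), Matrix.trace_mul_comm (R * M x), Matrix.mul_assoc]
    rw [mul_sub, Matrix.trace_sub, Matrix.mul_smul, Matrix.trace_smul, h3] at h2
    simp at h2
    exact h2
  have htr : R * R * (R * R) = σ := by rw [hRR, hSS]
  have hσ0 := trace_re_nonneg_of_posSemidef hσ.posSemidef
  have hsq : ∀ f u, 0 ≤ (hashDev h M f u * hashDev h M f u).trace.re := fun f u => by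
    have := Matrix.posSemidef_conjTranspose_mul_self (hashDev h M f u)
    rw [(hashDev_isHermitian h (fun x => (hM x).1) f u).eq] at this
    exact trace_re_nonneg_of_posSemidef this
  -- The Cauchy–Schwarz inequality for the sum over `u`, then for the average over `f`.
  have hf : ∀ f, ∑ u, traceNorm (hashDev h r f u) ≤
      √(σ.trace.re * 2 ^ ℓ) * √(∑ u, (hashDev h M f u * hashDev h M f u).trace.re) := fun f => by
    have h1 : ∑ u, √(hashDev h M f u * hashDev h M f u).trace.re ≤
        √(2 ^ ℓ) * √(∑ u, (hashDev h M f u * hashDev h M f u).trace.re) := by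
      have := Real.sum_sqrt_mul_sqrt_le (Finset.univ : Finset (Fin ℓ → Bool))
        (f := fun _ => 1) (g := fun u => (hashDev h M f u * hashDev h M f u).trace.re)
        (fun _ => zero_le_one) (hsq f)
      simpa using this
    rw [Real.sqrt_mul hσ0, mul_assoc]
    refine le_trans ?_ (mul_le_mul_of_nonneg_left h1 (Real.sqrt_nonneg _))
    rw [Finset.mul_sum]
    refine Finset.sum_le_sum fun u _ => ?_
    have := traceNorm_conj_le hR.1 (hashDev_isHermitian h (fun x => (hM x).1) f u)
    rwa [htr, ← hdev] at this
  have hcs : ∑ f, h.prob f * √(∑ u, (hashDev h M f u * hashDev h M f u).trace.re) ≤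
      √(∑ f, h.prob f * ∑ u, (hashDev h M f u * hashDev h M f u).trace.re) := by
    have := Real.sum_sqrt_mul_sqrt_le (Finset.univ : Finset F) (f := h.prob)
      (g := fun f => h.prob f * ∑ u, (hashDev h M f u * hashDev h M f u).trace.re)
      h.prob_nonneg
      (fun f => mul_nonneg (h.prob_nonneg f) (Finset.sum_nonneg fun u _ => hsq f u))
    rw [h.prob_sum, Real.sqrt_one, one_mul] at this
    refine le_trans (Finset.sum_le_sum fun f _ => ?_) this
    rw [Real.sqrt_mul (h.prob_nonneg f), ← mul_assoc, Real.mul_self_sqrt (h.prob_nonneg f)]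
  calc hashDist h r ≤ ∑ f, h.prob f * (√(σ.trace.re * 2 ^ ℓ) *
          √(∑ u, (hashDev h M f u * hashDev h M f u).trace.re)) :=
        Finset.sum_le_sum fun f _ => mul_le_mul_of_nonneg_left (hf f) (h.prob_nonneg f)
    _ = √(σ.trace.re * 2 ^ ℓ) *
          ∑ f, h.prob f * √(∑ u, (hashDev h M f u * hashDev h M f u).trace.re) := by
        rw [Finset.mul_sum]; exact Finset.sum_congr rfl fun f _ => by ring
    _ ≤ √(σ.trace.re * 2 ^ ℓ) * √(c * (∑ x, r x).trace.re) := by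
        refine mul_le_mul_of_nonneg_left (hcs.trans (Real.sqrt_le_sqrt ?_)) (Real.sqrt_nonneg _)
        refine (sum_hashDev_sq_le h hM).trans ?_
        rw [Matrix.trace_sum, Complex.re_sum, Finset.mul_sum]
        exact Finset.sum_le_sum fun x _ => hMM x
    _ = _ := by rw [← Real.sqrt_mul (by positivity), mul_assoc]

/-- The leftover hash lemma relative to a state `σ` of the adversary's system. -/
theorem hashDist_le_of_isDensity [DecidableEq X] (h : HashFamily X F ℓ) {r : X → Matrix n n ℂ}
    (hr : ∀ x, (r x).PosSemidef) {σ : Matrix n n ℂ} (hσ : IsDensity σ) {c : ℝ} (hc0 : 0 ≤ c)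
    (hc : ∀ x, ((c : ℂ) • σ - r x).PosSemidef) :
    hashDist h r ≤ √(2 ^ ℓ * (c * (∑ x, r x).trace.re)) := by
  -- `σ` need not be invertible, so `σ + η I` is used instead, and `η → 0`.
  have key : ∀ η : ℝ, 0 < η → hashDist h r ≤
      √((1 + η * Fintype.card n) * (2 ^ ℓ * (c * (∑ x, r x).trace.re))) := fun η hη => by
    have hη' : (0 : ℂ) < η := by exact_mod_cast hη
    have hpd : (σ + (η : ℂ) • (1 : Matrix n n ℂ)).PosDef :=
      Matrix.PosDef.posSemidef_add hσ.1 (Matrix.PosDef.one.smul hη')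
    have := hashDist_le_of_posDef h hr hpd (c := c) fun x => by
      rw [smul_add, add_sub_right_comm]
      refine (hc x).add ((Matrix.PosSemidef.one.smul hη'.le).smul ?_)
      exact_mod_cast hc0
    rw [Matrix.trace_add, hσ.2, Matrix.trace_smul, Matrix.trace_one] at this
    simpa using this
  have hlim : Filter.Tendsto (fun η : ℝ =>
      √((1 + η * Fintype.card n) * (2 ^ ℓ * (c * (∑ x, r x).trace.re))))
      (nhdsWithin 0 (Set.Ioi 0)) (nhds (√(2 ^ ℓ * (c * (∑ x, r x).trace.re)))) := by
    have : Continuous fun η : ℝ =>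
      √((1 + η * Fintype.card n) * (2 ^ ℓ * (c * (∑ x, r x).trace.re))) := by fun_prop
    have := (this.tendsto 0).mono_left (nhdsWithin_le_nhds (s := Set.Ioi 0))
    simpa using this
  exact ge_of_tendsto hlim (Filter.eventually_of_mem self_mem_nhdsWithin key)

end LeftoverHash

/-! ### Product bases -/

section WordVec

variable {𝒜 α β : Type*} [Fintype 𝒜] [Fintype α] [Fintype β]

/-- Completeness of the product basis `|q⟩`. -/
theorem sum_wordVec_mul_star [DecidableEq α] [DecidableEq β]
    (b : OrthonormalBasis 𝒜 ℂ (EuclideanSpace ℂ (α × β))) {ι : Type*} [Fintype ι] [DecidableEq ι]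
    (x x' : ι → α × β) :
    ∑ q : ι → 𝒜, wordVec b q x * star (wordVec b q x') = if x = x' then 1 else 0 := by
  have h1 : ∀ i j : α × β, ∑ a, b a i * star (b a j) = if i = j then 1 else 0 := fun i j => by
    have := b.sum_inner_mul_inner (EuclideanSpace.single i (1 : ℂ)) (EuclideanSpace.single j 1)
    simpa [EuclideanSpace.inner_single_left, EuclideanSpace.inner_single_right,
      Pi.single_apply, eq_comm (a := j)] using this
  simp only [wordVec, star_prod, ← Finset.prod_mul_distrib]
  rw [← Fintype.piFinset_univ, ← Finset.prod_univ_sum (fun _ => Finset.univ)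
    (fun i a => b a (x i) * star (b a (x' i)))]
  simp only [h1]
  by_cases h : x = x'
  · subst h; simp
  · obtain ⟨i, hi⟩ := Function.ne_iff.1 h
    rw [if_neg h]
    exact Finset.prod_eq_zero (Finset.mem_univ i) (if_neg hi)

/-- Orthonormality of the product basis `|q⟩`. -/
theorem sum_star_wordVec_mul [DecidableEq 𝒜]
    (b : OrthonormalBasis 𝒜 ℂ (EuclideanSpace ℂ (α × β))) {ι : Type*} [Fintype ι] [DecidableEq ι]
    (q q' : ι → 𝒜) :
    ∑ x : ι → α × β, star (wordVec b q x) * wordVec b q' x = if q = q' then 1 else 0 := by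
  have h1 : ∀ a a' : 𝒜, ∑ i, star (b a i) * b a' i = if a = a' then 1 else 0 := fun a a' => by
    have := orthonormal_iff_ite.1 b.orthonormal a a'
    simpa [PiLp.inner_apply, mul_comm] using this
  simp only [wordVec, star_prod, ← Finset.prod_mul_distrib]
  rw [← Fintype.piFinset_univ, ← Finset.prod_univ_sum (fun _ => Finset.univ)
    (fun i a => star (b (q i) a) * b (q' i) a)]
  simp only [h1]
  by_cases h : q = q'
  · subst h; simp
  · obtain ⟨i, hi⟩ := Function.ne_iff.1 h
    rw [if_neg h]
    exact Finset.prod_eq_zero (Finset.mem_univ i) (if_neg hi)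

/-- Measuring the positions in `t` is a complete measurement. -/
theorem sum_braOn_conjTranspose_mul {ε : Type*} {N : ℕ} [Fintype ε] [DecidableEq ε]
    [DecidableEq α] [DecidableEq β]
    (b : OrthonormalBasis 𝒜 ℂ (EuclideanSpace ℂ (α × β))) (t : Finset (Fin N)) :
    ∑ q : {i // i ∈ t} → 𝒜, (braOn (ε := ε) b t q).conjTranspose * braOn (ε := ε) b t q =
      (1 : Matrix ((Fin N → α × β) × ε) ((Fin N → α × β) × ε) ℂ) := by
  ext x x'
  simp only [Matrix.sum_apply, Matrix.mul_apply, Matrix.conjTranspose_apply, braOn,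
    Matrix.of_apply]
  have h1 : ∀ q : {i // i ∈ t} → 𝒜, ∑ y : ({i // i ∉ t} → α × β) × ε,
      star (if (fun i : {i // i ∉ t} => x.1 i.1) = y.1 ∧ x.2 = y.2 then
        star (wordVec b q fun i => x.1 i.1) else 0) *
      (if (fun i : {i // i ∉ t} => x'.1 i.1) = y.1 ∧ x'.2 = y.2 then
        star (wordVec b q fun i => x'.1 i.1) else 0) =
      if (fun i : {i // i ∉ t} => x'.1 i.1) = (fun i => x.1 i.1) ∧ x'.2 = x.2 then
        wordVec b q (fun i => x.1 i.1) * star (wordVec b q fun i => x'.1 i.1) else 0 := fun q => by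
    rw [Finset.sum_eq_single ((fun i : {i // i ∉ t} => x.1 i.1), x.2)]
    · simp
    · intro y _ hy
      rw [if_neg (fun hh => hy (Prod.ext hh.1.symm hh.2.symm)), star_zero, zero_mul]
    · simp
  simp only [h1]
  by_cases hx : (fun i : {i // i ∉ t} => x'.1 i.1) = (fun i => x.1 i.1) ∧ x'.2 = x.2
  · simp only [if_pos hx, sum_wordVec_mul_star, Matrix.one_apply]
    congr 1
    refine propext ⟨fun h => Prod.ext (funext fun i => ?_) hx.2.symm, fun h => by rw [h]⟩
    by_cases hi : i ∈ t
    · exact congrFun h ⟨i, hi⟩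
    · exact (congrFun hx.1 ⟨i, hi⟩).symm
  · have : x ≠ x' := fun h => hx (by rw [h]; exact ⟨rfl, rfl⟩)
    simp [if_neg hx, Matrix.one_apply_ne this]

end WordVec

/-! ### The protocol as a positive, trace non-increasing map -/

section Protocol

theorem IsCompletelyPositive.posSemidef {n m : Type*} {Φ : Matrix n n ℂ →ₗ[ℂ] Matrix m m ℂ}
    (hΦ : IsCompletelyPositive Φ) {M : Matrix n n ℂ} (hM : M.PosSemidef) : (Φ M).PosSemidef := by
  have := hΦ 1 (M.submatrix Prod.fst Prod.fst) (hM.submatrix _)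
  exact this.submatrix fun i => (i, (0 : Fin 1))

variable {𝒜 α β ε ε' τ Ω X : Type*} {N k : ℕ} [Fintype 𝒜] [Fintype α] [Fintype β] [Fintype ε]
  [Fintype τ] [DecidableEq α] [DecidableEq β] [DecidableEq ε]

section Sampling

variable (Ψ : SamplingStrategy 𝒜 N k τ Ω) (b : OrthonormalBasis 𝒜 ℂ (EuclideanSpace ℂ (α × β)))
  {M : τ → Matrix ((Fin N → α × β) × ε) ((Fin N → α × β) × ε) ℂ}

theorem sampleStep_posSemidef (hM : ∀ t, (M t).PosSemidef) (t : τ) (s : Ω) :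
    (sampleStep Ψ b M t s).PosSemidef := by
  classical
  refine Matrix.posSemidef_sum _ fun q _ => ?_
  split_ifs
  exacts [(hM t).mul_mul_conjTranspose_same _, Matrix.PosSemidef.zero]

theorem sampleStep_add_sub (S A C : τ → Matrix ((Fin N → α × β) × ε) ((Fin N → α × β) × ε) ℂ)
    (t : τ) (s : Ω) : sampleStep Ψ b (fun t => S t + (A t - C t)) t s =
      sampleStep Ψ b S t s + (sampleStep Ψ b A t s - sampleStep Ψ b C t s) := by
  simp only [sampleStep, ← Finset.sum_sub_distrib, ← Finset.sum_add_distrib]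
  refine Finset.sum_congr rfl fun q _ => ?_
  split_ifs
  · simp only [sandwich, Matrix.mul_add, Matrix.add_mul, Matrix.mul_sub, Matrix.sub_mul]
  · simp

theorem sum_trace_sampleStep [Fintype Ω]
    (M : τ → Matrix ((Fin N → α × β) × ε) ((Fin N → α × β) × ε) ℂ) (t : τ) :
    ∑ s, (sampleStep Ψ b M t s).trace = (M t).trace := by
  classical
  rw [← Matrix.trace_sum]
  simp only [sampleStep]
  rw [Finset.sum_comm]
  simp only [Finset.sum_ite_eq, Finset.mem_univ, if_true]
  rw [Matrix.trace_sum]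
  have : ∀ q, (sandwich (braOn (ε := ε) b (Ψ.sub t) q) (M t)).trace =
      ((braOn (ε := ε) b (Ψ.sub t) q).conjTranspose * braOn (ε := ε) b (Ψ.sub t) q * M t).trace :=
      fun q => by
    rw [sandwich, Matrix.trace_mul_comm, Matrix.mul_assoc]
  simp only [this]
  rw [← Matrix.trace_sum, ← Finset.sum_mul, sum_braOn_conjTranspose_mul, Matrix.one_mul]

end Sampling

variable [Fintype X] [Fintype ε'] {Ψ : SamplingStrategy 𝒜 N k τ Ω} (P : Protocol Ψ α β ε X ε')
  (b : OrthonormalBasis 𝒜 ℂ (EuclideanSpace ℂ (α × β)))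
  {M : τ → Matrix ((Fin N → α × β) × ε) ((Fin N → α × β) × ε) ℂ}

open Classical in
theorem preKey_eq (M : τ → Matrix ((Fin N → α × β) × ε) ((Fin N → α × β) × ε) ℂ) (t : τ) (s : Ω)
    (x y : X) : preKey P b M t s x y =
      if s ∈ P.accept then P.core t s x y (sampleStep Ψ b M t s) else 0 := by
  unfold preKey abortStep
  by_cases hs : s ∈ P.accept <;> simp [hs]

theorem preKey_posSemidef (hM : ∀ t, (M t).PosSemidef) (t : τ) (s : Ω) (x y : X) :
    (preKey P b M t s x y).PosSemidef := by
  rw [preKey_eq]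
  split_ifs
  exacts [(P.core_completelyPositive t s x y).posSemidef (sampleStep_posSemidef Ψ b hM t s),
    Matrix.PosSemidef.zero]

theorem sum_preKey_posSemidef (hM : ∀ t, (M t).PosSemidef) (t : τ) (s : Ω) (x : X) :
    (∑ y, preKey P b M t s x y).PosSemidef :=
  Matrix.posSemidef_sum _ fun y _ => preKey_posSemidef P b hM t s x y

theorem preKey_add_sub (S A C : τ → Matrix ((Fin N → α × β) × ε) ((Fin N → α × β) × ε) ℂ)
    (t : τ) (s : Ω) (x y : X) : preKey P b (fun t => S t + (A t - C t)) t s x y =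
      preKey P b S t s x y + (preKey P b A t s x y - preKey P b C t s x y) := by
  simp only [preKey_eq]
  split_ifs
  · rw [sampleStep_add_sub, map_add, map_sub]
  · simp

theorem okProbAt_nonneg (hM : ∀ t, (M t).PosSemidef) (t : τ) (s : Ω) :
    0 ≤ okProbAt P b M t s :=
  trace_re_nonneg_of_posSemidef <|
    Matrix.posSemidef_sum _ fun x _ => sum_preKey_posSemidef P b hM t s x

theorem okProbAt_le (hM : ∀ t, (M t).PosSemidef) (t : τ) (s : Ω) :
    okProbAt P b M t s ≤ (sampleStep Ψ b M t s).trace.re := by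
  have h := sampleStep_posSemidef Ψ b hM t s
  simp only [okProbAt, preKey_eq]
  by_cases hs : s ∈ P.accept
  · simpa only [if_pos hs] using P.core_trace_le t s _ h
  · simpa [hs] using trace_re_nonneg_of_posSemidef h

theorem okProbAt_eq_zero_of_notMem (t : τ) {s : Ω} (hs : s ∉ P.accept) :
    okProbAt P b M t s = 0 := by
  simp [okProbAt, preKey_eq, hs]

theorem sum_okProbAt_le [Fintype Ω] (hM : ∀ t, (M t).PosSemidef) :
    ∑ t, ∑ s, okProbAt P b M t s ≤ ∑ t, (M t).trace.re := by
  refine Finset.sum_le_sum fun t _ => ?_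
  rw [← sum_trace_sampleStep Ψ b M t, Complex.re_sum]
  exact Finset.sum_le_sum fun s _ => okProbAt_le P b hM t s

variable {F : Type*} [Fintype F] [DecidableEq F] [Fintype Ω] [DecidableEq Ω] [DecidableEq τ]

/-- The difference to be estimated, before normalization, is block diagonal with blocks given by
the deviations from uniform of the hash values. -/
theorem keyState_sub_uniform {ℓ : ℕ} (h : HashFamily X F ℓ)
    (M : τ → Matrix ((Fin N → α × β) × ε) ((Fin N → α × β) × ε) ℂ) :
    keyState P b h M - uniformBits ℓ ⊗ₖ traceLeft (keyState P b h M) =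
      ((okProb P b M : ℂ))⁻¹ • classicalQuantum fun u => classicalQuantum fun c : τ × Ω × F =>
        (h.prob c.2.2 : ℂ) • hashDev h (fun x => ∑ y, preKey P b M c.1 c.2.1 x y) c.2.2 u := by
  have hk : keyState P b h M = ((okProb P b M : ℂ))⁻¹ • classicalQuantum fun u =>
      classicalQuantum fun c : τ × Ω × F => (h.prob c.2.2 : ℂ) •
        ∑ x, if h.hash c.2.2 x = u then ∑ y, preKey P b M c.1 c.2.1 x y else 0 := by
    rw [keyState, finalState, traceLeft_smul, traceLeft_classicalQuantum, classicalQuantum_sum]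
    congr 2
    funext u
    rw [classicalQuantum_sum]
    congr 1
    funext c
    simp only [privacyAmp]
    rw [← Finset.smul_sum, Finset.sum_comm]
    congr 1
    refine Finset.sum_congr rfl fun x _ => ?_
    rw [Finset.sum_comm]
    by_cases hx : h.hash c.2.2 x = u <;> simp [hx]
  have ht : traceLeft (keyState P b h M) = ((okProb P b M : ℂ))⁻¹ •
      classicalQuantum fun c : τ × Ω × F => (h.prob c.2.2 : ℂ) •
        ∑ x, ∑ y, preKey P b M c.1 c.2.1 x y := by
    rw [hk, traceLeft_smul, traceLeft_classicalQuantum, classicalQuantum_sum]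
    congr 2
    funext c
    rw [← Finset.smul_sum, Finset.sum_comm]
    simp
  rw [ht, hk, uniformBits_kronecker]
  simp only [classicalQuantum_smul, classicalQuantum_sub]
  congr 1; funext u; congr 1; funext c
  rw [hashDev, smul_sub, smul_sub]
  congr 1
  simp only [smul_smul]
  congr 1
  ring

theorem okProb_mul_traceNorm_le [DecidableEq ε'] {ℓ : ℕ} (h : HashFamily X F ℓ)
    (hM : ∀ t, (M t).PosSemidef) :
    okProb P b M * traceNorm (keyState P b h M - uniformBits ℓ ⊗ₖ traceLeft (keyState P b h M)) ≤
      ∑ t, ∑ s, hashDist h fun x => ∑ y, preKey P b M t s x y := by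
  have hdev : ∀ (c : τ × Ω × F) u,
      (hashDev h (fun x => ∑ y, preKey P b M c.1 c.2.1 x y) c.2.2 u).IsHermitian := fun c u =>
    hashDev_isHermitian h (fun x => (sum_preKey_posSemidef P b hM _ _ x).1) _ _
  have hblock : ∀ (c : τ × Ω × F) u, ((h.prob c.2.2 : ℂ) •
      hashDev h (fun x => ∑ y, preKey P b M c.1 c.2.1 x y) c.2.2 u).IsHermitian := fun c u => by
    simp [Matrix.IsHermitian, Matrix.conjTranspose_smul, (hdev c u).eq]
  have hcq : (classicalQuantum fun u => classicalQuantum fun c : τ × Ω × F =>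
      (h.prob c.2.2 : ℂ) •
        hashDev h (fun x => ∑ y, preKey P b M c.1 c.2.1 x y) c.2.2 u).IsHermitian :=
    classicalQuantum_isHermitian fun u => classicalQuantum_isHermitian fun c => hblock c u
  have hp : 0 ≤ okProb P b M :=
    Finset.sum_nonneg fun t _ => Finset.sum_nonneg fun s _ => okProbAt_nonneg P b hM t s
  have h1 : okProb P b M *
      traceNorm (keyState P b h M - uniformBits ℓ ⊗ₖ traceLeft (keyState P b h M)) ≤
      traceNorm (classicalQuantum fun u => classicalQuantum fun c : τ × Ω × F =>
      (h.prob c.2.2 : ℂ) •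
        hashDev h (fun x => ∑ y, preKey P b M c.1 c.2.1 x y) c.2.2 u) := by
    rw [keyState_sub_uniform, ← Complex.ofReal_inv]
    refine (mul_le_mul_of_nonneg_left (traceNorm_smul_le hcq (inv_nonneg.2 hp)) hp).trans ?_
    rw [← mul_assoc]
    exact mul_le_of_le_one_left (traceNorm_nonneg _) mul_inv_le_one
  refine h1.trans ((traceNorm_classicalQuantum_le fun u =>
    classicalQuantum_isHermitian fun c => hblock c u).trans ?_)
  refine (Finset.sum_le_sum fun u _ => traceNorm_classicalQuantum_le fun c => hblock c u).trans ?_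
  refine (Finset.sum_le_sum fun u _ => Finset.sum_le_sum fun c _ =>
    traceNorm_smul_le (hdev c u) (h.prob_nonneg _)).trans_eq ?_
  rw [Finset.sum_comm]
  simp only [Fintype.sum_prod_type, hashDist, Finset.mul_sum]

end Protocol

/-! ### Existence of ideal states -/

section IdealState

/-- The gentle measurement lemma: projecting a state onto a subspace of weight `p` and
renormalizing changes it by at most `2 √(1 - p)`.  For `ρ = W W†` this compares `W` with `P W / √p`, whose Hilbert–Schmidt inner
product is `√p`. -/
theorem gentle_measurement {n : Type*} [Fintype n] [DecidableEq n] {ρ P : Matrix n n ℂ}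
    (hρ : IsDensity ρ) (hP : P.IsHermitian) (hPP : P * P = P) (hp : 0 < (P * ρ).trace.re) :
    IsDensity ((((P * ρ).trace.re : ℝ) : ℂ)⁻¹ • (P * ρ * P)) ∧
      traceNorm (ρ - (((P * ρ).trace.re : ℝ) : ℂ)⁻¹ • (P * ρ * P)) ≤
        2 * √(1 - (P * ρ).trace.re) := by
  set p := (P * ρ).trace.re with hpdef
  have hpsd : (P * ρ * P).PosSemidef := by
    have := hρ.1.mul_mul_conjTranspose_same P
    rwa [hP.eq] at this
  have htr : (P * ρ * P).trace = (P * ρ).trace := by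
    rw [Matrix.trace_mul_comm, ← Matrix.mul_assoc, hPP]
  have htrp : (P * ρ * P).trace = (p : ℂ) :=
    Complex.ext (by rw [htr, Complex.ofReal_re])
      (by rw [Complex.ofReal_im]; exact (Complex.le_def.1 hpsd.trace_nonneg).2.symm)
  have hinv : (0 : ℂ) ≤ (p : ℂ)⁻¹ := by
    rw [← Complex.ofReal_inv]; exact_mod_cast (inv_pos.2 hp).le
  refine ⟨⟨hpsd.smul hinv, ?_⟩, ?_⟩
  · rw [Matrix.trace_smul, htrp, smul_eq_mul, inv_mul_cancel₀ (by exact_mod_cast hp.ne')]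
  obtain ⟨B, hB⟩ := exists_eq_conjTranspose_mul_self hρ.1
  obtain ⟨W, hW⟩ : ∃ W : Matrix n n ℂ, ρ = W * Wᴴ :=
    ⟨Bᴴ, by rw [Matrix.conjTranspose_conjTranspose, hB]⟩
  set s : ℝ := √p with hs
  have hs0 : 0 < s := Real.sqrt_pos.2 hp
  have hss : s * s = p := Real.mul_self_sqrt hp.le
  set V : Matrix n n ℂ := ((s⁻¹ : ℝ) : ℂ) • (P * W) with hV
  have hVH : Vᴴ = ((s⁻¹ : ℝ) : ℂ) • (Wᴴ * P) := by
    rw [hV, Matrix.conjTranspose_smul, Matrix.conjTranspose_mul, hP.eq]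
    simp
  have hσ : (p : ℂ)⁻¹ • (P * ρ * P) = V * Vᴴ := by
    rw [hVH, hV, Matrix.smul_mul, Matrix.mul_smul, smul_smul, ← Complex.ofReal_mul, ← mul_inv,
      hss, Complex.ofReal_inv, hW]
    simp only [Matrix.mul_assoc]
  have hWW : (Wᴴ * W).trace.re = 1 := by
    rw [Matrix.trace_mul_comm, ← hW, hρ.2, Complex.one_re]
  have hWPW : (Wᴴ * (P * W)).trace.re = p := by
    rw [Matrix.trace_mul_comm, Matrix.mul_assoc, ← hW]
  have hsp : s⁻¹ * p = s := by rw [← hss]; field_simp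
  have hWV : (Wᴴ * V).trace.re = s := by
    rw [hV, Matrix.mul_smul, Matrix.trace_smul, smul_eq_mul, Complex.re_ofReal_mul, hWPW, hsp]
  have hVW : (Vᴴ * W).trace.re = s := by
    rw [hVH, Matrix.smul_mul, Matrix.trace_smul, smul_eq_mul, Complex.re_ofReal_mul,
      Matrix.mul_assoc, hWPW, hsp]
  have hVV : (Vᴴ * V).trace.re = 1 := by
    rw [hVH, hV, Matrix.smul_mul, Matrix.mul_smul, smul_smul, Matrix.trace_smul, smul_eq_mul,
      ← Complex.ofReal_mul, Complex.re_ofReal_mul, Matrix.mul_assoc, ← Matrix.mul_assoc P P, hPP,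
      hWPW, mul_assoc, hsp, inv_mul_cancel₀ hs0.ne']
  have h1 : ((W - V)ᴴ * (W - V)).trace.re = 2 - 2 * s := by
    simp only [Matrix.conjTranspose_sub, Matrix.sub_mul, Matrix.mul_sub, Matrix.trace_sub,
      Complex.sub_re, hWW, hWV, hVW, hVV]
    ring
  have h2 : ((W + V)ᴴ * (W + V)).trace.re = 2 + 2 * s := by
    simp only [Matrix.conjTranspose_add, Matrix.add_mul, Matrix.mul_add, Matrix.trace_add,
      Complex.add_re, hWW, hWV, hVW, hVV]
    ring
  have h3 : 0 ≤ 2 - 2 * s := by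
    rw [← h1]; exact trace_re_nonneg_of_posSemidef (Matrix.posSemidef_conjTranspose_mul_self _)
  have h4 := traceNorm_mul_conjTranspose_sub_le W V
  rw [h1, h2, ← Real.sqrt_mul h3, ← hW, ← hσ] at h4
  refine h4.trans_eq ?_
  rw [show (2 - 2 * s) * (2 + 2 * s) = 2 ^ 2 * (1 - p) by rw [← hss]; ring,
    Real.sqrt_mul (by positivity), Real.sqrt_sq (by norm_num)]

/-- The projection `|q⟩⟨q| ⊗ id_E`. -/
noncomputable def wordProj {𝒜 α β : Type*} {N : ℕ} [Fintype 𝒜] [Fintype α] [Fintype β]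
    (b : OrthonormalBasis 𝒜 ℂ (EuclideanSpace ℂ (α × β))) (ε : Type*) [DecidableEq ε]
    (q : Fin N → 𝒜) :
    Matrix ((Fin N → α × β) × ε) ((Fin N → α × β) × ε) ℂ :=
  Matrix.vecMulVec (wordVec b q) (star (wordVec b q)) ⊗ₖ 1

theorem sum_wordProj {𝒜 α β ε : Type*} {N : ℕ} [Fintype 𝒜] [Fintype α] [Fintype β]
    [DecidableEq α] [DecidableEq β] [DecidableEq ε]
    (b : OrthonormalBasis 𝒜 ℂ (EuclideanSpace ℂ (α × β))) :
    ∑ q : Fin N → 𝒜, wordProj b ε q =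
      (1 : Matrix ((Fin N → α × β) × ε) ((Fin N → α × β) × ε) ℂ) := by
  ext ⟨x, e⟩ ⟨x', e'⟩
  have := sum_wordVec_mul_star b x x'
  simp only [Matrix.sum_apply, wordProj, Matrix.kroneckerMap_apply, Matrix.vecMulVec_apply,
    Pi.star_apply, ← Finset.sum_mul, this, Matrix.one_apply, Prod.mk.injEq]
  split_ifs <;> simp_all

variable {𝒜 α β ε τ Ω : Type*} {N k : ℕ} [Fintype 𝒜] [Fintype α] [Fintype β] [Fintype ε]
  [DecidableEq ε]

open Classical in
/-- The orthogonal projection onto `span {|q⟩ : q ∈ G} ⊗ H_E`. -/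
noncomputable def goodProj (b : OrthonormalBasis 𝒜 ℂ (EuclideanSpace ℂ (α × β))) (ε : Type*)
    [DecidableEq ε] (G : Set (Fin N → 𝒜)) :
    Matrix ((Fin N → α × β) × ε) ((Fin N → α × β) × ε) ℂ :=
  ∑ q, if q ∈ G then wordProj b ε q else 0

variable (b : OrthonormalBasis 𝒜 ℂ (EuclideanSpace ℂ (α × β)))

theorem wordProj_posSemidef (q : Fin N → 𝒜) : (wordProj b ε q).PosSemidef := by
  classical
  exact (Matrix.posSemidef_vecMulVec_self_star _).kronecker Matrix.PosSemidef.one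

theorem wordProj_mul [DecidableEq 𝒜] (q q' : Fin N → 𝒜) :
    wordProj b ε q * wordProj b ε q' = if q = q' then wordProj b ε q else 0 := by
  have h := sum_star_wordVec_mul b q q'
  rw [wordProj, wordProj, ← Matrix.mul_kronecker_mul, Matrix.one_mul,
    Matrix.vecMulVec_mul_vecMulVec]
  have h' : star (wordVec b q) ⬝ᵥ wordVec b q' = if q = q' then 1 else 0 := h
  rw [h']
  split_ifs with hq
  · subst hq; simp
  · simp

theorem goodProj_isHermitian (G : Set (Fin N → 𝒜)) : (goodProj b ε G).IsHermitian := by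
  classical
  refine (Matrix.posSemidef_sum _ fun q _ => ?_).1
  split_ifs
  exacts [wordProj_posSemidef b q, Matrix.PosSemidef.zero]

theorem goodProj_mul_self (G : Set (Fin N → 𝒜)) :
    goodProj b ε G * goodProj b ε G = goodProj b ε G := by
  classical
  simp only [goodProj]
  rw [Finset.sum_mul_sum]
  refine Finset.sum_congr rfl fun q _ => ?_
  rw [Finset.sum_eq_single q]
  · split_ifs
    · rw [wordProj_mul, if_pos rfl]
    · simp
  · intro q' _ hq
    split_ifs <;> simp [wordProj_mul, Ne.symm hq]
  · simp

theorem goodProj_mulVec_mem (G : Set (Fin N → 𝒜)) (v : (Fin N → α × β) × ε → ℂ) :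
    goodProj b ε G *ᵥ v ∈ wordSpace b ε G := by
  classical
  rw [goodProj, Matrix.sum_mulVec]
  refine Submodule.sum_mem _ fun q _ => ?_
  split_ifs with hq
  · refine Submodule.subset_span ⟨q, hq, fun e => ∑ x, star (wordVec b q x) * v (x, e), ?_⟩
    funext ⟨x, e⟩
    simp [Matrix.mulVec, dotProduct, wordProj, Fintype.sum_prod_type, Matrix.vecMulVec_apply,
      Matrix.one_apply, Finset.mul_sum, mul_assoc]
  · rw [Matrix.zero_mulVec]; exact Submodule.zero_mem _

/-- The probability of the outcome `q` when the state `ρ` is measured in the product basis. -/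
noncomputable def wordProb (ρ : Matrix ((Fin N → α × β) × ε) ((Fin N → α × β) × ε) ℂ)
    (q : Fin N → 𝒜) : ℝ :=
  (wordProj b ε q * ρ).trace.re

variable {b} {ρ : Matrix ((Fin N → α × β) × ε) ((Fin N → α × β) × ε) ℂ}

theorem wordProb_nonneg (hρ : IsDensity ρ) (q : Fin N → 𝒜) : 0 ≤ wordProb b ρ q :=
  trace_mul_re_nonneg_of_posSemidef (wordProj_posSemidef b q) hρ.1

variable [DecidableEq α] [DecidableEq β]

theorem sum_wordProb (hρ : IsDensity ρ) : ∑ q, wordProb b ρ q = 1 := by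
  simp only [wordProb]
  rw [← Complex.re_sum, ← Matrix.trace_sum, ← Finset.sum_mul, sum_wordProj, Matrix.one_mul, hρ.2,
    Complex.one_re]

open Classical in
theorem one_sub_trace_goodProj_mul (hρ : IsDensity ρ) (G : Set (Fin N → 𝒜)) :
    1 - (goodProj b ε G * ρ).trace.re = ∑ q, if q ∉ G then wordProb b ρ q else 0 := by
  rw [goodProj, Finset.sum_mul, Matrix.trace_sum, Complex.re_sum, ← sum_wordProb (b := b) hρ,
    ← Finset.sum_sub_distrib]
  refine Finset.sum_congr rfl fun q _ => ?_
  by_cases hq : q ∈ G <;> simp [hq, wordProb]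

open Classical in
/-- A state is close to a state living in the space of the words in `G`, if measuring it gives a
word in `G` with high probability. -/
theorem exists_isDensity_near (hρ : IsDensity ρ) {G : Set (Fin N → 𝒜)} (hG : G.Nonempty) :
    ∃ σ : Matrix ((Fin N → α × β) × ε) ((Fin N → α × β) × ε) ℂ,
      IsDensity σ ∧ (∀ v, σ *ᵥ v ∈ wordSpace b ε G) ∧ (IsPure ρ → IsPure σ) ∧
      traceNorm (ρ - σ) ≤ 2 * √(∑ q, if q ∉ G then wordProb b ρ q else 0) := by
  rw [← one_sub_trace_goodProj_mul hρ G]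
  have hp0 : 0 ≤ (goodProj b ε G * ρ).trace.re := by
    rw [goodProj, Finset.sum_mul, Matrix.trace_sum, Complex.re_sum]
    refine Finset.sum_nonneg fun q _ => ?_
    split_ifs
    · exact wordProb_nonneg hρ q
    · simp
  have hH := goodProj_isHermitian (ε := ε) b G
  rcases hp0.eq_or_lt with hp | hp
  · -- `ρ` is orthogonal to the good space: any pure product state in that space will do.
    obtain ⟨q, hq⟩ := hG
    obtain ⟨e₀⟩ : Nonempty ε := by
      by_contra hne
      rw [not_nonempty_iff] at hne
      exact zero_ne_one (α := ℂ)
        (by rw [← hρ.2, Matrix.trace, Finset.univ_eq_empty, Finset.sum_empty])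
    set z : (Fin N → α × β) × ε → ℂ := fun x =>
      wordVec b q x.1 * Pi.single (M := fun _ => ℂ) e₀ 1 x.2 with hz
    have htr : (Matrix.vecMulVec z (star z)).trace = 1 := by
      have h := sum_star_wordVec_mul b q q
      rw [if_pos rfl] at h
      rw [← h]
      simp [Matrix.trace, Matrix.vecMulVec_apply, hz, Fintype.sum_prod_type, Pi.single_apply,
        mul_comm]
    have hσ : IsDensity (Matrix.vecMulVec z (star z)) :=
      ⟨Matrix.posSemidef_vecMulVec_self_star z, htr⟩
    refine ⟨Matrix.vecMulVec z (star z), hσ, fun v => ?_, fun _ => ⟨z, rfl⟩, ?_⟩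
    · have : Matrix.vecMulVec z (star z) *ᵥ v = (star z ⬝ᵥ v) • z := by
        funext x
        simp only [Matrix.mulVec, dotProduct, Matrix.vecMulVec_apply, Pi.smul_apply, smul_eq_mul,
          Finset.sum_mul]
        exact Finset.sum_congr rfl fun i _ => by ring
      rw [this]
      exact Submodule.smul_mem _ _ (Submodule.subset_span ⟨q, hq, Pi.single e₀ 1, rfl⟩)
    · refine (traceNorm_sub_le hρ.1 hσ.1).trans_eq ?_
      rw [← hp, hρ.2, htr]
      norm_num
  · obtain ⟨h1, h2⟩ := gentle_measurement hρ hH (goodProj_mul_self b G) hp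
    refine ⟨_, h1, fun v => ?_, ?_, h2⟩
    · rw [Matrix.smul_mulVec, Matrix.mul_assoc, ← Matrix.mulVec_mulVec]
      exact Submodule.smul_mem _ _ (goodProj_mulVec_mem b G _)
    · rintro ⟨v, hv⟩
      set p := (goodProj b ε G * ρ).trace.re
      refine ⟨((√p)⁻¹ : ℂ) • (goodProj b ε G *ᵥ v), ?_⟩
      have hpp : ((√p)⁻¹ : ℂ) * star ((√p)⁻¹ : ℂ) = (p : ℂ)⁻¹ := by
        rw [← Complex.ofReal_inv, Complex.star_def, Complex.conj_ofReal, ← Complex.ofReal_mul,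
          ← mul_inv, Real.mul_self_sqrt hp.le, Complex.ofReal_inv]
      rw [hv, star_smul, Matrix.vecMulVec_smul, Matrix.smul_vecMulVec, smul_smul, mul_comm, hpp,
        Matrix.mul_vecMulVec, Matrix.vecMulVec_mul, Matrix.star_mulVec, hH.eq]

variable [Fintype τ] (Ψ : SamplingStrategy 𝒜 N k τ Ω) (δ : ℝ)

open Classical in
theorem le_errorProb (q : Fin N → 𝒜) :
    ∑ t, (if q ∉ Ψ.goodWords δ t then Ψ.prob t else 0) ≤ Ψ.errorProb δ :=
  le_ciSup (f := fun q : Fin N → 𝒜 => ∑ t, if q ∉ Ψ.goodWords δ t then Ψ.prob t else 0)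
    (Set.finite_range _).bddAbove q

open Classical in
/-- The average, over the random choice, of the probability of measuring a bad word. -/
theorem sum_prob_mul_le_errorProb (hρ : IsDensity ρ) :
    ∑ t, Ψ.prob t * ∑ q, (if q ∉ Ψ.goodWords δ t then wordProb b ρ q else 0) ≤
      Ψ.errorProb δ := by
  calc ∑ t, Ψ.prob t * ∑ q, (if q ∉ Ψ.goodWords δ t then wordProb b ρ q else 0)
      = ∑ q, wordProb b ρ q * ∑ t, if q ∉ Ψ.goodWords δ t then Ψ.prob t else 0 := by
        simp only [Finset.mul_sum]
        rw [Finset.sum_comm]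
        refine Finset.sum_congr rfl fun q _ => Finset.sum_congr rfl fun t _ => ?_
        split_ifs <;> ring
    _ ≤ ∑ q, wordProb b ρ q * Ψ.errorProb δ :=
        Finset.sum_le_sum fun q _ =>
          mul_le_mul_of_nonneg_left (le_errorProb Ψ δ q) (wordProb_nonneg hρ q)
    _ = Ψ.errorProb δ := by rw [← Finset.sum_mul, sum_wordProb hρ, one_mul]

theorem exists_isIdealState [DecidableEq τ] (b : OrthonormalBasis 𝒜 ℂ (EuclideanSpace ℂ (α × β)))
    (hρ : IsDensity ρ)
    (hG : ∀ t, 0 < Ψ.prob t → (Ψ.goodWords δ t).Nonempty) :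
    ∃ σ : τ → Matrix ((Fin N → α × β) × ε) ((Fin N → α × β) × ε) ℂ,
      IsIdealState Ψ b δ ρ σ ∧ (IsPure ρ → ∀ t, 0 < Ψ.prob t → IsPure (σ t)) := by
  classical
  have hex : ∀ t, ∃ σ : Matrix ((Fin N → α × β) × ε) ((Fin N → α × β) × ε) ℂ, σ.IsHermitian ∧
      (0 < Ψ.prob t → IsDensity σ ∧ (∀ v, σ *ᵥ v ∈ wordSpace b ε (Ψ.goodWords δ t)) ∧
        (IsPure ρ → IsPure σ) ∧ traceNorm (ρ - σ) ≤
          2 * √(∑ q, if q ∉ Ψ.goodWords δ t then wordProb b ρ q else 0)) := fun t => by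
    by_cases ht : 0 < Ψ.prob t
    · obtain ⟨σ, h⟩ := exists_isDensity_near (b := b) hρ (hG t ht)
      exact ⟨σ, h.1.1.1, fun _ => h⟩
    · exact ⟨0, Matrix.isHermitian_zero, fun h => absurd h ht⟩
  choose σ hσH hσ using hex
  refine ⟨σ, ⟨fun t ht => ⟨(hσ t ht).1, (hσ t ht).2.1⟩, ?_⟩, fun hp t ht => (hσ t ht).2.2.1 hp⟩
  have hH : ∀ t, (ρ - σ t).IsHermitian := fun t => hρ.1.1.sub (hσH t)
  set e : τ → ℝ := fun t => ∑ q, if q ∉ Ψ.goodWords δ t then wordProb b ρ q else 0 with he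
  have he0 : ∀ t, 0 ≤ e t := fun t => Finset.sum_nonneg fun q _ => by
    split_ifs
    exacts [le_rfl, wordProb_nonneg hρ q]
  have h1 : traceNorm (classicalQuantum fun t => (Ψ.prob t : ℂ) • (ρ - σ t)) ≤
      ∑ t, 2 * (Ψ.prob t * √(e t)) := by
    refine (traceNorm_classicalQuantum_le fun t => ?_).trans (Finset.sum_le_sum fun t _ => ?_)
    · simp only [Matrix.IsHermitian, Matrix.conjTranspose_smul, (hH t).eq, Complex.star_def,
        Complex.conj_ofReal]
    · refine (traceNorm_smul_le (hH t) (Ψ.prob_nonneg t)).trans ?_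
      rcases (Ψ.prob_nonneg t).eq_or_lt with h0 | h0
      · simp [← h0]
      · have := mul_le_mul_of_nonneg_left (hσ t h0).2.2.2 h0.le
        linarith
  have h2 : ∑ t, Ψ.prob t * √(e t) ≤ √(∑ t, Ψ.prob t * e t) := by
    have := Real.sum_sqrt_mul_sqrt_le (Finset.univ : Finset τ) (f := Ψ.prob)
      (g := fun t => Ψ.prob t * e t) Ψ.prob_nonneg
      (fun t => mul_nonneg (Ψ.prob_nonneg t) (he0 t))
    rw [Ψ.prob_sum, Real.sqrt_one, one_mul] at this
    refine le_trans (Finset.sum_le_sum fun t _ => ?_) this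
    rw [Real.sqrt_mul (Ψ.prob_nonneg t), ← mul_assoc, Real.mul_self_sqrt (Ψ.prob_nonneg t)]
  have h3 := Real.sqrt_le_sqrt (sum_prob_mul_le_errorProb (b := b) Ψ δ hρ)
  rw [← Finset.mul_sum] at h1
  linarith

end IdealState

/-! ### Conditional min-entropy -/

section MinEntropy

theorem exists_smul_one_sub_posSemidef {n : Type*} [Fintype n] [DecidableEq n] {M : Matrix n n ℂ}
    (hM : M.IsHermitian) :
    ∃ c : ℝ, 0 < c ∧ ((c : ℂ) • (1 : Matrix n n ℂ) - M).PosSemidef := by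
  obtain ⟨V, -, hVV', hs⟩ := exists_diagonalization hM
  set d := hM.eigenvalues
  refine ⟨1 + ∑ i, |d i|, by positivity, ?_⟩
  have h : ((1 + ∑ i, |d i| : ℝ) : ℂ) • (1 : Matrix n n ℂ) - M =
      V * Matrix.diagonal (fun i => ((1 + ∑ i, |d i| - d i : ℝ) : ℂ)) * Vᴴ := by
    have : Matrix.diagonal (fun i => ((1 + ∑ i, |d i| - d i : ℝ) : ℂ)) =
        ((1 + ∑ i, |d i| : ℝ) : ℂ) • (1 : Matrix n n ℂ) - Matrix.diagonal (fun i => (d i : ℂ)) := by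
      rw [Matrix.smul_one_eq_diagonal, Matrix.diagonal_sub]
      simp only [Complex.ofReal_sub]
    rw [this, Matrix.mul_sub, Matrix.sub_mul, ← hs, Matrix.mul_smul, Matrix.smul_mul,
      Matrix.mul_one, hVV']
  rw [h]
  refine (Matrix.PosSemidef.diagonal fun i => ?_).mul_mul_conjTranspose_same V
  have h1 := Finset.single_le_sum (f := fun i => |d i|) (fun i _ => abs_nonneg (d i))
    (Finset.mem_univ i)
  have h2 := le_abs_self (d i)
  simp only [Pi.zero_apply]
  exact_mod_cast (by linarith : 0 ≤ 1 + ∑ i, |d i| - d i)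

/-- Every number below the conditional min-entropy is achieved.  The set in its definition is
nonempty, as the maximally mixed state `σ` shows. -/
theorem exists_isDensity_of_lt_condMinEntropy {A E : Type*} [Fintype A] [DecidableEq A] [Fintype E]
    [DecidableEq E] {ρ : Matrix (A × E) (A × E) ℂ} (hρ : IsDensity ρ) {h : ℝ}
    (hh : h < condMinEntropy ρ) :
    ∃ σ : Matrix E E ℂ, IsDensity σ ∧
      ((((2 : ℝ) ^ (-h) : ℝ) : ℂ) • ((1 : Matrix A A ℂ) ⊗ₖ σ) - ρ).PosSemidef := by
  have hne : {h : ℝ | ∃ σ : Matrix E E ℂ, IsDensity σ ∧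
      ((((2 : ℝ) ^ (-h) : ℝ) : ℂ) • ((1 : Matrix A A ℂ) ⊗ₖ σ) - ρ).PosSemidef}.Nonempty := by
    obtain ⟨c, hc, hpos⟩ := exists_smul_one_sub_posSemidef hρ.1.1
    have hE : Nonempty E := by
      by_contra hne
      rw [not_nonempty_iff] at hne
      exact zero_ne_one (α := ℂ)
        (by rw [← hρ.2, Matrix.trace, Finset.univ_eq_empty, Finset.sum_empty])
    have hcard : (0 : ℝ) < Fintype.card E := by exact_mod_cast Fintype.card_pos
    refine ⟨-Real.logb 2 (c * Fintype.card E), ((Fintype.card E : ℂ))⁻¹ • 1, ⟨?_, ?_⟩, ?_⟩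
    · refine Matrix.PosSemidef.one.smul ?_
      rw [← Complex.ofReal_natCast, ← Complex.ofReal_inv]
      exact_mod_cast (inv_pos.2 hcard).le
    · rw [Matrix.trace_smul, Matrix.trace_one, smul_eq_mul, inv_mul_cancel₀]
      exact_mod_cast hcard.ne'
    · rw [neg_neg, Real.rpow_logb two_pos (by norm_num) (mul_pos hc hcard),
        Matrix.kronecker_smul, Matrix.one_kronecker_one, smul_smul]
      convert hpos using 3
      push_cast
      rw [mul_assoc, mul_inv_cancel₀ (by exact_mod_cast hcard.ne'), mul_one]
  obtain ⟨h', ⟨σ, hσ, hpos⟩, hlt⟩ := exists_lt_of_lt_csSup hne hh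
  refine ⟨σ, hσ, ?_⟩
  have hle : (2 : ℝ) ^ (-h') ≤ (2 : ℝ) ^ (-h) :=
    Real.rpow_le_rpow_of_exponent_le one_le_two (by linarith)
  have hd : (0 : ℂ) ≤ (((2 : ℝ) ^ (-h) - (2 : ℝ) ^ (-h') : ℝ) : ℂ) := by
    exact_mod_cast sub_nonneg.2 hle
  have := ((Matrix.PosSemidef.one (n := A) (R := ℂ)).kronecker hσ.1).smul hd
  rw [show (((2 : ℝ) ^ (-h) : ℝ) : ℂ) = (((2 : ℝ) ^ (-h) - (2 : ℝ) ^ (-h') : ℝ) : ℂ) +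
    (((2 : ℝ) ^ (-h') : ℝ) : ℂ) by push_cast; ring, add_smul, add_sub_assoc]
  exact this.add hpos

end MinEntropy

/-! ### Security of the key -/

section Security

variable {𝒜 α β ε ε' τ Ω X F : Type*} {N k : ℕ} [Fintype 𝒜] [Fintype α] [Fintype β] [Fintype ε]
  [Fintype τ] [DecidableEq α] [DecidableEq β] [DecidableEq ε] [Fintype X] [Fintype ε']
  [DecidableEq ε'] [Fintype F] {Ψ : SamplingStrategy 𝒜 N k τ Ω} (P : Protocol Ψ α β ε X ε')
  (b : OrthonormalBasis 𝒜 ℂ (EuclideanSpace ℂ (α × β)))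
  {M : τ → Matrix ((Fin N → α × β) × ε) ((Fin N → α × β) × ε) ℂ} {ℓ : ℕ} (h : HashFamily X F ℓ)

/-- For the state produced by the protocol, the deviation from uniform is at most twice the weight
of the state. -/
theorem hashDist_preKey_le (hM : ∀ t, (M t).PosSemidef) (t : τ) (s : Ω) :
    hashDist h (fun x => ∑ y, preKey P b M t s x y) ≤ 2 * okProbAt P b M t s :=
  hashDist_le_two_mul_trace h fun x => sum_preKey_posSemidef P b hM t s x

/-- The leftover hash lemma for the state conditioned on `T = t`, `S = s`, `R = 0`. -/
theorem hashDist_preKey_le_of_condMinEntropy [DecidableEq X] (hM : ∀ t, (M t).PosSemidef) {t : τ}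
    {s : Ω} {γ : ℝ} (hq : 0 < okProbAt P b M t s)
    (hγ : γ ≤ condMinEntropy (condState P b M t s)) :
    hashDist h (fun x => ∑ y, preKey P b M t s x y) ≤
      okProbAt P b M t s * (2 : ℝ) ^ (-(1 / 2) * (γ - ℓ)) := by
  have hr : ∀ x, (∑ y, preKey P b M t s x y).PosSemidef := sum_preKey_posSemidef P b hM t s
  set r : X → Matrix ε' ε' ℂ := fun x => ∑ y, preKey P b M t s x y with hrdef
  have hqdef : okProbAt P b M t s = (∑ x, r x).trace.re := rfl
  have hsum : (∑ x, r x).PosSemidef := Matrix.posSemidef_sum _ fun x _ => hr x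
  have htr : (∑ x, r x).trace = (okProbAt P b M t s : ℂ) :=
    Complex.ext (by rw [hqdef, Complex.ofReal_re])
      (by rw [Complex.ofReal_im]; exact (Complex.le_def.1 hsum.trace_nonneg).2.symm)
  set q := okProbAt P b M t s
  have hqC : (q : ℂ) ≠ 0 := by exact_mod_cast hq.ne'
  have hq0 : (0 : ℂ) ≤ (q : ℂ) := by exact_mod_cast hq.le
  have hcond : condState P b M t s = (q : ℂ)⁻¹ • classicalQuantum r := rfl
  have hdens : IsDensity (condState P b M t s) := by
    rw [hcond]
    refine ⟨(classicalQuantum_posSemidef hr).smul ?_, ?_⟩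
    · rw [← Complex.ofReal_inv]; exact_mod_cast (inv_pos.2 hq).le
    · rw [Matrix.trace_smul, trace_classicalQuantum, ← Matrix.trace_sum, htr, smul_eq_mul,
        inv_mul_cancel₀ hqC]
  have key : ∀ h' < γ, hashDist h r ≤ q * (2 : ℝ) ^ (-(1 / 2) * (h' - ℓ)) := fun h' hh' => by
    obtain ⟨σ, hσ, hpos⟩ := exists_isDensity_of_lt_condMinEntropy hdens (hh'.trans_le hγ)
    have hblock : ∀ x, (((q * (2 : ℝ) ^ (-h') : ℝ) : ℂ) • σ - r x).PosSemidef := fun x => by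
      have h1 := (hpos.submatrix (Prod.mk x)).smul hq0
      convert h1 using 1
      ext i j
      rw [hcond]
      simp [classicalQuantum_apply, Matrix.kroneckerMap_apply, mul_sub, mul_assoc, hqC]
    refine (hashDist_le_of_isDensity h hr hσ (by positivity) hblock).trans_eq ?_
    rw [← hqdef]
    have h2 : (2 : ℝ) ^ ℓ * (2 : ℝ) ^ (-h') = ((2 : ℝ) ^ (-(1 / 2) * (h' - ℓ))) ^ 2 := by
      rw [← Real.rpow_natCast 2 ℓ, ← Real.rpow_natCast _ 2, ← Real.rpow_add two_pos,
        ← Real.rpow_mul two_pos.le]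
      congr 1
      push_cast
      ring
    rw [show (2 : ℝ) ^ ℓ * (q * (2 : ℝ) ^ (-h') * q) =
      (q * (2 : ℝ) ^ (-(1 / 2) * (h' - ℓ))) ^ 2 by rw [mul_pow, ← h2]; ring,
      Real.sqrt_sq (by positivity)]
  -- The supremum `γ` itself need not be achieved: pass to the limit `h' → γ`.
  have hcont : Continuous fun h' : ℝ => q * (2 : ℝ) ^ (-(1 / 2) * (h' - ℓ)) := by
    refine continuous_const.mul (Continuous.rpow continuous_const (by fun_prop) fun _ => ?_)
    exact Or.inl two_ne_zero
  exact ge_of_tendsto ((hcont.tendsto γ).mono_left (nhdsWithin_le_nhds (s := Set.Iio γ)))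
    (Filter.eventually_of_mem self_mem_nhdsWithin key)

variable [Fintype Ω] [DecidableEq Ω] [DecidableEq τ] [DecidableEq F] {δ : ℝ}
  {ρ : Matrix ((Fin N → α × β) × ε) ((Fin N → α × β) × ε) ℂ}
  {σ : τ → Matrix ((Fin N → α × β) × ε) ((Fin N → α × β) × ε) ℂ}

/-- The ideal state bounds the insecurity of the key obtained from the real state. -/
theorem IsIdealState.okProb_mul_traceNorm_le [DecidableEq X] (hρ : IsDensity ρ)
    (hσ : IsIdealState Ψ b δ ρ σ) {γ : ℝ}
    (hγ : ∀ t, ∀ s ∈ P.accept, 0 < okProbAt P b (fun t => (Ψ.prob t : ℂ) • σ t) t s →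
      γ ≤ condMinEntropy (condState P b (fun t => (Ψ.prob t : ℂ) • σ t) t s)) :
    okProb P b (fun t => (Ψ.prob t : ℂ) • ρ) *
        traceNorm (keyState P b h (fun t => (Ψ.prob t : ℂ) • ρ) -
          uniformBits ℓ ⊗ₖ traceLeft (keyState P b h (fun t => (Ψ.prob t : ℂ) • ρ))) ≤
      (2 : ℝ) ^ (-(1 / 2) * (γ - ℓ)) + 4 * √(Ψ.errorProb δ) := by
  have hp0 : ∀ t, (0 : ℂ) ≤ (Ψ.prob t : ℂ) := fun t => by exact_mod_cast Ψ.prob_nonneg t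
  have hR : ∀ t, ((Ψ.prob t : ℂ) • ρ).PosSemidef := fun t => hρ.1.smul (hp0 t)
  set S : τ → Matrix ((Fin N → α × β) × ε) ((Fin N → α × β) × ε) ℂ :=
    fun t => (Ψ.prob t : ℂ) • σ t with hSdef
  have hS : ∀ t, (S t).PosSemidef ∧ (S t).trace.re = Ψ.prob t := fun t => by
    rcases (Ψ.prob_nonneg t).eq_or_lt with h0 | h0
    · simp [hSdef, ← h0, Matrix.PosSemidef.zero]
    · have hd := (hσ.1 t h0).1
      exact ⟨hd.1.smul (hp0 t), by simp [hSdef, Matrix.trace_smul, hd.2]⟩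
  have hD : ∀ t, ((Ψ.prob t : ℂ) • (ρ - σ t)).IsHermitian := fun t => by
    rw [smul_sub]; exact (hR t).1.sub (hS t).1.1
  obtain ⟨A, C, hA, hC, hAC, hn⟩ := exists_posSemidef_sub_blocks hD
  have hsplit : (fun t => (Ψ.prob t : ℂ) • ρ) = fun t => S t + (A t - C t) := by
    funext t
    rw [← hAC, hSdef, ← smul_add, add_sub_cancel]
  have hideal : ∀ t s, hashDist h (fun x => ∑ y, preKey P b S t s x y) ≤
      okProbAt P b S t s * (2 : ℝ) ^ (-(1 / 2) * (γ - ℓ)) := fun t s => by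
    rcases (okProbAt_nonneg P b (fun t => (hS t).1) t s).eq_or_lt with h0 | h0
    · refine (hashDist_preKey_le P b h (fun t => (hS t).1) t s).trans_eq ?_
      rw [← h0, mul_zero, zero_mul]
    · have hs : s ∈ P.accept := by
        by_contra hs
        exact h0.ne' (okProbAt_eq_zero_of_notMem P b t hs)
      exact hashDist_preKey_le_of_condMinEntropy P b h (fun t => (hS t).1) h0 (hγ t s hs h0)
  have hterm : ∀ t s,
      hashDist h (fun x => ∑ y, preKey P b (fun t => S t + (A t - C t)) t s x y) ≤
      okProbAt P b S t s * (2 : ℝ) ^ (-(1 / 2) * (γ - ℓ)) +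
        (2 * okProbAt P b A t s + 2 * okProbAt P b C t s) := fun t s => by
    simp only [preKey_add_sub, Finset.sum_add_distrib, Finset.sum_sub_distrib]
    refine (hashDist_add_sub_le h (fun x => (sum_preKey_posSemidef P b (fun t => (hS t).1) t s x).1)
      (fun x => (sum_preKey_posSemidef P b hA t s x).1)
      (fun x => (sum_preKey_posSemidef P b hC t s x).1)).trans ?_
    exact add_le_add (hideal t s)
      (add_le_add (hashDist_preKey_le P b h hA t s) (hashDist_preKey_le P b h hC t s))
  have hbound := QKD.okProb_mul_traceNorm_le P b h hR
  refine hbound.trans ?_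
  rw [hsplit]
  refine (Finset.sum_le_sum fun t _ => Finset.sum_le_sum fun s _ => hterm t s).trans ?_
  simp only [Finset.sum_add_distrib, ← Finset.sum_mul, ← Finset.mul_sum]
  have h1 := sum_okProbAt_le P b fun t => (hS t).1
  simp only [fun t => (hS t).2, Ψ.prob_sum] at h1
  have h2 := mul_le_mul_of_nonneg_right h1
    (Real.rpow_nonneg two_pos.le (-(1 / 2) * (γ - (ℓ : ℝ))))
  have h3 := sum_okProbAt_le P b hA
  have h4 := sum_okProbAt_le P b hC
  have h5 := hσ.2
  rw [hn] at h5
  linarith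

end Security

end QKD

theorem mainTheorem2
    {𝒜 α β ε ε' τ Ω X F : Type*}
    [Fintype 𝒜] [Fintype α] [DecidableEq α] [Fintype β] [DecidableEq β]
    [Fintype ε] [DecidableEq ε] [Fintype ε'] [DecidableEq ε'] [Fintype τ] [DecidableEq τ]
    [Fintype Ω] [DecidableEq Ω] [Fintype X] [DecidableEq X] [Fintype F] [DecidableEq F]
    {N k : ℕ} (Ψ : QKD.SamplingStrategy 𝒜 N k τ Ω)
    (b : OrthonormalBasis 𝒜 ℂ (EuclideanSpace ℂ (α × β)))
    (δ : ℝ) (hδ : 0 < δ)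
    (ρ : Matrix ((Fin N → α × β) × ε) ((Fin N → α × β) × ε) ℂ) (hρ : QKD.IsDensity ρ) :
    -- ideal states exist
    ((∀ t, 0 < Ψ.prob t → (Ψ.goodWords δ t).Nonempty) →
      ∃ σ : τ → Matrix ((Fin N → α × β) × ε) ((Fin N → α × β) × ε) ℂ,
        QKD.IsIdealState Ψ b δ ρ σ ∧
        (QKD.IsPure ρ → ∀ t, 0 < Ψ.prob t → QKD.IsPure (σ t))) ∧
    -- and each of them controls the security of the real protocol
    (∀ σ : τ → Matrix ((Fin N → α × β) × ε) ((Fin N → α × β) × ε) ℂ,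
      QKD.IsIdealState Ψ b δ ρ σ →
      ∀ (P : QKD.Protocol Ψ α β ε X ε') (γ : ℝ),
        (∀ t, ∀ s ∈ P.accept,
          0 < QKD.okProbAt P b (fun t => (Ψ.prob t : ℂ) • σ t) t s →
          γ ≤ QKD.condMinEntropy (QKD.condState P b (fun t => (Ψ.prob t : ℂ) • σ t) t s)) →
        ∀ (ℓ : ℕ) (h : QKD.HashFamily X F ℓ),
          QKD.okProb P b (fun t => (Ψ.prob t : ℂ) • ρ) *
              QKD.traceNorm
                (QKD.keyState P b h (fun t => (Ψ.prob t : ℂ) • ρ) -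
                  QKD.uniformBits ℓ ⊗ₖ
                    QKD.traceLeft (QKD.keyState P b h (fun t => (Ψ.prob t : ℂ) • ρ)))
            ≤ (2 : ℝ) ^ (-(1 / 2) * (γ - ℓ)) + 4 * Real.sqrt (Ψ.errorProb δ)) := by
  refine ⟨QKD.exists_isIdealState Ψ δ b hρ, fun σ hσ P γ hγ ℓ h => ?_⟩
  exact hσ.okProb_mul_traceNorm_le P b h hρ hγ
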